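/- Let $n\ge 2$, $\sigma\in(0,1)$, $c_1>0$, and let $q\in(1,\infty)$ with $q>2\sigma$. There is a constant $C>0$, depending only on $n,\sigma,q$ and $c_1$, such that the following holds. Let $J:\mathbb R^n\times\mathbb R^n\to[0,\infty)$ be bounded, continuous and symmetric ($J(x,y)=J(y,x)$), with $J(\cdot,y)\in L^1(\mathbb R^n)$ for every $y\in\mathbb R^n$ and $$J(x,y)\ \ge\ c_1|x-y|^{-(n+2\sigma)}\qquad\text{whenever } |x-y|>1 .$$ Let $u_0\in L^1(\mathbb R^n)\cap L^\infty(\mathbb R^n)$ and let $u$ be a solution of $$\partial_t u(t,x)=\int_{\mathbb R^n}J(x,y)\,\bigl(u(t,y)-u(t,x)\bigr)\,dy ,\qquad u(0,\cdot)=u_0 ,$$ meaning that $u(t)\in L^1\cap L^\infty$ for all $t\ge 0$, that $t\mapsto u(t)$ is continuous from $[0,\infty)$ to $L^1(\mathbb R^n)$ and bounded in $L^\infty(\mathbb R^n)$ on bounded time intervals (for instance $u\in C([0,\infty);L^1\cap L^\infty)$), that $u(0,\cdot)=u_0$ almost everywhere, and that for almost every $x$ the equation holds at every $t>0$. Then $\|u(t)\|_{L^q(\mathbb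 R^n)}\to 0$ as $t\to\infty$, $$\limsup_{t\to\infty}\ t^{\frac{n}{2\sigma}\left(1-\frac1q\right)}\,\|u(t)\|_{L^q(\mathbb R^n)}\ \le\ C\,\|u_0\|_{L^1(\mathbb R^n)} ,$$ and, for all $t>0$, $$\|u(t)\|_{L^q(\mathbb R^n)}\ \le\ C\,\max\bigl\{\|u_0\|_{L^1(\mathbb R^n)},\|u_0\|_{L^q(\mathbb R^n)}\bigr\}\;t^{-\frac{n}{2\sigma}\left(1-\frac1q\right)} .$$ -/

import Mathlib

open MeasureTheory Filter Topology
open scoped ENNReal NNReal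

/-- The standing assumptions on a jump kernel `J(x, y)` on `ℝⁿ × ℝⁿ`: it is nonnegative, bounded,
jointly continuous and symmetric, each section `J(·, y)` is integrable, and
`J(x, y) ≥ c₁ |x - y|^{-(n + 2σ)}` for `|x - y| > 1`. -/
structure IsFatTailKernel (n : ℕ) (σ c₁ : ℝ)
    (J : EuclideanSpace ℝ (Fin n) → EuclideanSpace ℝ (Fin n) → ℝ) : Prop where
  nonneg : ∀ x y, 0 ≤ J x y
  bounded : ∃ M : ℝ, ∀ x y, J x y ≤ M
  continuous : Continuous (Function.uncurry J)
  symm : ∀ x y, J x y = J y x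
  integrable : ∀ y, Integrable (fun x => J x y) volume
  tail : ∀ x y, 1 < ‖x - y‖ → c₁ * ‖x - y‖ ^ (-((n : ℝ) + 2 * σ)) ≤ J x y

/-- `u` is a solution on `[0, ∞)` of `∂ₜ u(t, x) = ∫ J(x, y) (u(t, y) - u(t, x)) dy` with
`u(0) = u₀`. Each `u(t)`, `t ≥ 0`, lies in `L¹ ∩ L^∞`, the curve `t ↦ u(t)` is continuous
from `[0, ∞)` to `L¹` and bounded in `L^∞` on bounded time intervals, and for almost every `x` the
equation holds pointwise at every `t > 0`. (Every curve that is continuous from `[0, ∞)`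
to `L¹ ∩ L^∞` meets the continuity and boundedness requirements.) -/
structure IsNonlocalHeatSolution {n : ℕ}
    (J : EuclideanSpace ℝ (Fin n) → EuclideanSpace ℝ (Fin n) → ℝ)
    (u₀ : EuclideanSpace ℝ (Fin n) → ℝ) (u : ℝ → EuclideanSpace ℝ (Fin n) → ℝ) : Prop where
  memLp_one : ∀ t, 0 ≤ t → MemLp (u t) 1 volume
  memLp_top : ∀ t, 0 ≤ t → MemLp (u t) ∞ volume
  continuous_L1 : ∀ t, 0 ≤ t →
    Tendsto (fun s => eLpNorm (u s - u t) 1 volume) (𝓝[Set.Ici 0] t) (𝓝 0)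
  bounded_Linfty : ∀ T : ℝ, ∃ M : ℝ≥0, ∀ t, 0 ≤ t → t ≤ T → eLpNorm (u t) ∞ volume ≤ M
  initial : u 0 =ᵐ[volume] u₀
  equation : ∀ᵐ x ∂(volume : Measure (EuclideanSpace ℝ (Fin n))), ∀ t, 0 < t →
    HasDerivAt (fun s => u s x) (∫ y, J x y * (u t y - u t x)) t

/-!
The decay is obtained by the energy method, arranged so that no Sobolev or Fourier theory is needed.

*Nash inequality.* Write `φ s = |s| ^ (q - 1) sign s` (`signedPow`), and fix a scale `R ≥ 1`. For each
`x` compare `v x` with the values of `v` on the annulus `R < |x - y| < 2R`. Either `|v y| ≤ |v x| / 2` on half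
of the annulus, and then `(φ (v x) - φ (v y)) (v x - v y)` controls `|v x| ^ q` there; or `|v x|` is at most
four times the mean of `|v|` on the annulus. As `J ≥ c₁ (2R) ^ -(n + 2σ)` on the annulus, integration over
`x` gives `nash_inequality`:
`∫ |v| ^ q ≲ R ^ (2σ) ∬ J (φ (v x) - φ (v y)) (v x - v y) + R ^ (-n (q - 1)) (∫ |v|) ^ q`.

*Energy inequality.* The total jump rate `∫ J x y dy` may be unbounded, so the equation cannot be
tested directly with `φ (u)`. Instead it is tested with `φ` of a soft truncation of `u` at level `ε`, on sets
`K` of bounded rate (`rateExhaustion`). By symmetry of `J` this produces the dissipation of the truncation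
restricted to `K`, with an error at most a constant times the mass of `u` outside `K`
(`setIntegral_signedPow_mul_le`). The constant is finite because `J` is bounded and the truncated
power is integrable. The error vanishes as `K` exhausts the space, uniformly on bounded time
intervals; then `ε → 0`. With exponents tending to `1` the same inequality yields the contraction of
the `L¹` norm.

*Decay.* Both parts give, for `Y t = ∫ |u t| ^ q`, `m = ∫ |u 0|` and all `R ≥ 1`, `s ≤ t`,
`Y t ≤ exp (-κ R ^ (-2σ) (t - s)) Y s + A R ^ (-n (q - 1)) m ^ q`
(`IsNonlocalHeatSolution.exists_integral_rpow_le`). With `s = t / 2` and `R ^ (2σ)` a small multiple of `t`,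
the quantity `Z t = t ^ (n (q - 1) / (2σ)) Y t` satisfies `Z t ≤ Z (t / 2) / 2 + D m ^ q` for large `t`
(`exists_halving_recursion`). Iteration bounds `Z` at all times, and asymptotically by a multiple of
`m ^ q` alone. Taking `q`-th roots gives the three claims.
-/

/-! ### Signed powers and soft thresholding -/

/-- The odd power `s ↦ |s| ^ (p - 1) sign s`, written through positive and negative parts; it is
`1 / p` times the derivative of `|s| ^ p`. -/
noncomputable def signedPow (p s : ℝ) : ℝ := max s 0 ^ (p - 1) - max (-s) 0 ^ (p - 1)

/-- Soft thresholding at level `ε`: the values in `[-ε, ε]` are sent to `0` and all others are moved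
towards `0` by `ε`. -/
def softThreshold (ε s : ℝ) : ℝ := max (s - ε) 0 - max (-s - ε) 0

/-- The increment product `(φ a - φ b) (a - b)` of `φ = signedPow p`; integrated against the jump
kernel it is the rate at which the `Lᵖ` norm is dissipated. -/
noncomputable def signedPairing (p a b : ℝ) : ℝ := (signedPow p a - signedPow p b) * (a - b)

lemma signedPow_neg (p s : ℝ) : signedPow p (-s) = -signedPow p s := by
  simp [signedPow]

lemma signedPow_of_nonneg {p s : ℝ} (hp : 1 < p) (hs : 0 ≤ s) : signedPow p s = s ^ (p - 1) := by
  simp [signedPow, hs, Real.zero_rpow (by linarith : p - 1 ≠ 0)]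

lemma signedPow_zero {p : ℝ} (hp : 1 < p) : signedPow p 0 = 0 := by
  rw [signedPow_of_nonneg hp le_rfl, Real.zero_rpow (by linarith)]

lemma signedPow_monotone {p : ℝ} (hp : 1 < p) : Monotone (signedPow p) := by
  intro a b hab
  have h1 : max a 0 ^ (p - 1) ≤ max b 0 ^ (p - 1) :=
    Real.rpow_le_rpow (le_max_right _ _) (max_le_max_right _ hab) (by linarith)
  have h2 : max (-b) 0 ^ (p - 1) ≤ max (-a) 0 ^ (p - 1) :=
    Real.rpow_le_rpow (le_max_right _ _) (max_le_max_right _ (by linarith)) (by linarith)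
  unfold signedPow; linarith

lemma continuous_signedPow {p : ℝ} (hp : 1 < p) : Continuous (signedPow p) := by
  unfold signedPow
  exact ((continuous_id.max continuous_const).rpow_const fun _ => Or.inr (by linarith)).sub
    ((continuous_id.neg.max continuous_const).rpow_const fun _ => Or.inr (by linarith))

lemma abs_signedPow {p : ℝ} (hp : 1 < p) (s : ℝ) : |signedPow p s| = |s| ^ (p - 1) := by
  rcases le_total 0 s with hs | hs
  · rw [signedPow_of_nonneg hp hs, abs_of_nonneg (Real.rpow_nonneg hs _), abs_of_nonneg hs]
  · rw [← neg_neg s, signedPow_neg, abs_neg, abs_neg,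
      signedPow_of_nonneg hp (by linarith : 0 ≤ -s), abs_of_nonneg (Real.rpow_nonneg (by linarith) _),
      abs_of_nonneg (by linarith : 0 ≤ -s)]

/-- Coercivity of the increment product when `b` is much smaller than `a`. -/
lemma mul_abs_rpow_le_signedPairing {p : ℝ} (hp : 1 < p) {a b : ℝ} (hab : |b| ≤ |a| / 2) :
    (1 - 2 ^ (1 - p)) / 2 * |a| ^ p ≤ signedPairing p a b := by
  unfold signedPairing
  -- by oddness it is enough to treat `0 ≤ a`
  have key : ∀ a b : ℝ, 0 ≤ a → |b| ≤ a / 2 →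
      (1 - 2 ^ (1 - p)) / 2 * a ^ p ≤ (signedPow p a - signedPow p b) * (a - b) := by
    intro a b ha hb
    rcases ha.eq_or_lt with rfl | ha'
    · have : b = 0 := by
        rw [zero_div] at hb; exact abs_eq_zero.1 (le_antisymm hb (abs_nonneg _))
      simp [this, Real.zero_rpow (by linarith : p ≠ 0)]
    have h1 : signedPow p b ≤ signedPow p (a / 2) :=
      signedPow_monotone hp (le_trans (le_abs_self b) hb)
    rw [signedPow_of_nonneg hp (by linarith : 0 ≤ a / 2), Real.div_rpow ha (by norm_num)] at h1
    rw [signedPow_of_nonneg hp ha]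
    have h2 : a / 2 ≤ a - b := by linarith [le_abs_self b]
    have h3 : (1 : ℝ) - 2 ^ (1 - p) = 1 - (2 ^ (p - 1))⁻¹ := by
      rw [← Real.rpow_neg (by norm_num)]; ring_nf
    have h4 : a ^ p = a ^ (p - 1) * a := by
      rw [← Real.rpow_add_one ha'.ne']; ring_nf
    have h5 : (1 : ℝ) ≤ 2 ^ (p - 1) := Real.one_le_rpow (by norm_num) (by linarith)
    have h6 : 0 ≤ a ^ (p - 1) := Real.rpow_nonneg ha _
    have h7 : a ^ (p - 1) / 2 ^ (p - 1) ≤ a ^ (p - 1) := div_le_self h6 h5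
    calc (1 - 2 ^ (1 - p)) / 2 * a ^ p
        = (a ^ (p - 1) - a ^ (p - 1) / 2 ^ (p - 1)) * (a / 2) := by rw [h3, h4]; field_simp
      _ ≤ (a ^ (p - 1) - signedPow p b) * (a - b) := by
        apply mul_le_mul <;> linarith
  rcases le_total 0 a with ha | ha
  · rw [abs_of_nonneg ha] at hab ⊢; exact key a b ha hab
  · have := key (-a) (-b) (by linarith) (by rwa [abs_neg, ← abs_of_nonpos ha])
    rw [signedPow_neg, signedPow_neg] at this
    rw [abs_of_nonpos ha]; linarith

lemma signedPairing_nonneg {p : ℝ} (hp : 1 < p) (a b : ℝ) : 0 ≤ signedPairing p a b := by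
  unfold signedPairing
  rcases le_total a b with h | h
  · exact mul_nonneg_of_nonpos_of_nonpos (by linarith [signedPow_monotone hp h]) (by linarith)
  · exact mul_nonneg (by linarith [signedPow_monotone hp h]) (by linarith)

lemma continuous_softThreshold (ε : ℝ) : Continuous (softThreshold ε) := by
  unfold softThreshold; fun_prop

lemma softThreshold_monotone (ε : ℝ) : Monotone (softThreshold ε) := by
  intro a b h
  unfold softThreshold
  have h1 : max (a - ε) 0 ≤ max (b - ε) 0 := max_le_max_right _ (by linarith)
  have h2 : max (-b - ε) 0 ≤ max (-a - ε) 0 := max_le_max_right _ (by linarith)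
  linarith

lemma softThreshold_sub_le {ε a b : ℝ} (hε : 0 < ε) (h : b ≤ a) :
    softThreshold ε a - softThreshold ε b ≤ a - b := by
  unfold softThreshold
  rcases max_cases (a - ε) 0 with h1 | h1 <;> rcases max_cases (-a - ε) 0 with h2 | h2 <;>
  rcases max_cases (b - ε) 0 with h3 | h3 <;> rcases max_cases (-b - ε) 0 with h4 | h4 <;> linarith

lemma tendsto_softThreshold (s : ℝ) : Tendsto (fun ε => softThreshold ε s) (𝓝 0) (𝓝 s) := by
  have h : Continuous fun ε => softThreshold ε s := by unfold softThreshold; fun_prop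
  have h0 : softThreshold 0 s = s := by
    unfold softThreshold
    rcases le_total 0 s with hs | hs
    · simp [hs]
    · simp [hs]
  simpa [h0] using h.tendsto 0

lemma abs_softThreshold {ε : ℝ} (hε : 0 < ε) (s : ℝ) :
    |softThreshold ε s| = max (|s| - ε) 0 := by
  unfold softThreshold
  rcases le_total 0 s with hs | hs
  · rw [abs_of_nonneg hs, max_eq_right (by linarith : -s - ε ≤ 0), sub_zero,
      abs_of_nonneg (le_max_right _ _)]
  · rw [abs_of_nonpos hs, max_eq_right (by linarith : s - ε ≤ 0), zero_sub, abs_neg,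
      abs_of_nonneg (le_max_right _ _)]

lemma abs_softThreshold_le {ε : ℝ} (hε : 0 < ε) (s : ℝ) : |softThreshold ε s| ≤ |s| := by
  rw [abs_softThreshold hε]; exact max_le (by linarith) (abs_nonneg _)

/-- `softThreshold ε` is the identity minus a nondecreasing function, hence pairing increments of
an increasing function of the truncation with increments of `s` only increases the result. -/
lemma signedPow_softThreshold_pairing {p ε : ℝ} (hp : 1 < p) (hε : 0 < ε) (a b : ℝ) :
    signedPairing p (softThreshold ε a) (softThreshold ε b)
      ≤ (signedPow p (softThreshold ε a) - signedPow p (softThreshold ε b)) * (a - b) := by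
  unfold signedPairing
  rcases le_total b a with h | h
  · exact mul_le_mul_of_nonneg_left (softThreshold_sub_le hε h)
      (by linarith [signedPow_monotone hp (softThreshold_monotone ε h)])
  · exact mul_le_mul_of_nonpos_left (by linarith [softThreshold_sub_le hε h])
      (by linarith [signedPow_monotone hp (softThreshold_monotone ε h)])

lemma signedPow_softThreshold_mul_self {p ε : ℝ} (hp : 1 < p) (hε : 0 < ε) (a : ℝ) :
    signedPow p (softThreshold ε a) * softThreshold ε a ≤ signedPow p (softThreshold ε a) * a := by
  have := signedPow_softThreshold_pairing hp hε a 0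
  have h0 : softThreshold ε 0 = 0 := by simp [softThreshold, hε.le]
  simpa [signedPairing, h0, signedPow_zero hp] using this

/-- The truncated power vanishes near `0`, so it is dominated linearly on bounded sets. -/
lemma abs_signedPow_softThreshold_le {p ε B s : ℝ} (hp : 1 < p) (hε : 0 < ε) (hs : |s| ≤ B) :
    |signedPow p (softThreshold ε s)| ≤ B ^ (p - 1) / ε * |s| := by
  rw [abs_signedPow hp, abs_softThreshold hε]
  have hB : 0 ≤ B := (abs_nonneg s).trans hs
  rcases le_total |s| ε with h | h
  · rw [max_eq_right (by linarith), Real.zero_rpow (by linarith)]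
    positivity
  · have h1 : max (|s| - ε) 0 ^ (p - 1) ≤ B ^ (p - 1) :=
      Real.rpow_le_rpow (le_max_right _ _) (max_le (by linarith) hB) (by linarith)
    refine h1.trans ?_
    rw [div_mul_eq_mul_div, le_div_iff₀ hε]
    exact mul_le_mul_of_nonneg_left h (by positivity)

lemma hasDerivAt_max_zero_rpow {p : ℝ} (hp : 1 < p) (s : ℝ) :
    HasDerivAt (fun x : ℝ => max x 0 ^ p) (p * max s 0 ^ (p - 1)) s := by
  rcases lt_trichotomy s 0 with hs | rfl | hs
  · rw [max_eq_right hs.le, Real.zero_rpow (by linarith), mul_zero]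
    refine (hasDerivAt_const s (0 : ℝ)).congr_of_eventuallyEq ?_
    filter_upwards [Iio_mem_nhds hs] with x hx
    rw [max_eq_right (le_of_lt hx), Real.zero_rpow (by linarith)]
  · have h := hasDerivAt_abs_rpow 0 hp
    simp only [mul_zero] at h
    rw [max_self, Real.zero_rpow (by linarith), mul_zero]
    rw [hasDerivAt_iff_isLittleO] at h ⊢
    refine Asymptotics.IsBigO.trans_isLittleO ?_ h
    refine Asymptotics.IsBigO.of_bound 1 (Eventually.of_forall fun x => ?_)
    simp only [max_self, abs_zero, Real.zero_rpow (by linarith : p ≠ 0), sub_zero, smul_zero,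
      one_mul, Real.norm_eq_abs]
    rw [abs_of_nonneg (by positivity), abs_of_nonneg (by positivity)]
    exact Real.rpow_le_rpow (le_max_right _ _) (max_le (le_abs_self _) (abs_nonneg _)) (by linarith)
  · rw [max_eq_left hs.le]
    refine (Real.hasDerivAt_rpow_const (Or.inl hs.ne')).congr_of_eventuallyEq ?_
    filter_upwards [Ioi_mem_nhds hs] with x hx
    rw [max_eq_left (le_of_lt hx)]

lemma abs_softThreshold_rpow {p ε : ℝ} (hp : 1 < p) (hε : 0 < ε) (s : ℝ) :
    |softThreshold ε s| ^ p = max (s - ε) 0 ^ p + max (-s - ε) 0 ^ p := by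
  rw [abs_softThreshold hε]
  have h0 : (0 : ℝ) ^ p = 0 := Real.zero_rpow (by linarith)
  rcases le_total 0 s with hs | hs
  · rw [abs_of_nonneg hs, max_eq_right (by linarith : -s - ε ≤ 0), h0, add_zero]
  · rw [abs_of_nonpos hs, max_eq_right (by linarith : s - ε ≤ 0), h0, zero_add]

lemma signedPow_softThreshold {p ε : ℝ} (hp : 1 < p) (hε : 0 < ε) (s : ℝ) :
    signedPow p (softThreshold ε s) = max (s - ε) 0 ^ (p - 1) - max (-s - ε) 0 ^ (p - 1) := by
  have h0 : (0 : ℝ) ^ (p - 1) = 0 := Real.zero_rpow (by linarith)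
  unfold softThreshold
  rcases le_total 0 s with hs | hs
  · rw [max_eq_right (by linarith : -s - ε ≤ 0), sub_zero,
      signedPow_of_nonneg hp (le_max_right _ _), h0, sub_zero]
  · rw [max_eq_right (by linarith : s - ε ≤ 0), zero_sub, signedPow_neg,
      signedPow_of_nonneg hp (le_max_right _ _), h0, zero_sub]

lemma hasDerivAt_abs_softThreshold_rpow {p ε : ℝ} (hp : 1 < p) (hε : 0 < ε) (s : ℝ) :
    HasDerivAt (fun x : ℝ => |softThreshold ε x| ^ p)
      (p * signedPow p (softThreshold ε s)) s := by
  simp_rw [abs_softThreshold_rpow hp hε, signedPow_softThreshold hp hε]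
  have h1 := (hasDerivAt_max_zero_rpow hp (s - ε)).comp s ((hasDerivAt_id s).sub_const ε)
  have h2 := (hasDerivAt_max_zero_rpow hp (-s - ε)).comp s ((hasDerivAt_id s).neg.sub_const ε)
  refine (h1.add h2).congr_deriv ?_
  simp only [mul_one]
  ring

/-- Lipschitz bound that transfers continuity in `L¹` to the truncated power. -/
lemma abs_softThreshold_rpow_sub_le {p ε B : ℝ} (hp : 1 < p) (hε : 0 < ε) {a b : ℝ}
    (ha : |a| ≤ B) (hb : |b| ≤ B) :
    |(|softThreshold ε a| ^ p) - |softThreshold ε b| ^ p| ≤ p * B ^ (p - 1) * |a - b| := by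
  have := (convex_Icc (-B) B).norm_image_sub_le_of_norm_hasDerivWithin_le
    (f := fun x : ℝ => |softThreshold ε x| ^ p) (C := p * B ^ (p - 1))
    (f' := fun s => p * signedPow p (softThreshold ε s)) (x := b) (y := a)
    (fun x _ => (hasDerivAt_abs_softThreshold_rpow hp hε x).hasDerivWithinAt)
    (fun x hx => ?_) (abs_le.1 hb) (abs_le.1 ha)
  · simpa using this
  · rw [norm_mul, Real.norm_eq_abs, Real.norm_eq_abs, abs_of_pos (by linarith : 0 < p),
      abs_signedPow hp]
    exact mul_le_mul_of_nonneg_left (Real.rpow_le_rpow (abs_nonneg _)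
      ((abs_softThreshold_le hε x).trans (abs_le.2 hx)) (by linarith)) (by linarith)

lemma abs_rpow_le_mul_abs {p B a : ℝ} (hp : 1 ≤ p) (ha : |a| ≤ B) :
    |a| ^ p ≤ B ^ (p - 1) * |a| := by
  have h : |a| ^ p = |a| ^ (p - 1) * |a| := by
    rcases (abs_nonneg a).eq_or_lt with h | h
    · rw [← h, Real.zero_rpow (by linarith), mul_zero]
    · rw [← Real.rpow_add_one h.ne']; ring_nf
  rw [h]
  exact mul_le_mul_of_nonneg_right (Real.rpow_le_rpow (abs_nonneg _) ha (by linarith))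
    (abs_nonneg _)

/-! ### A Nash inequality at scales larger than one -/

lemma continuous_signedPairing {p : ℝ} (hp : 1 < p) :
    Continuous fun z : ℝ × ℝ => signedPairing p z.1 z.2 := by
  unfold signedPairing
  exact (((continuous_signedPow hp).comp continuous_fst).sub
    ((continuous_signedPow hp).comp continuous_snd)).mul (continuous_fst.sub continuous_snd)

/-- Comparison of the value `a` with the values of `v` on a set of mass `P`: either `v` is smaller
than `|a| / 2` on at least half of the mass, and the increment product controls `|a| ^ p` there, or
`|a|` is at most four times the mean of `|v|`. -/
lemma mul_abs_rpow_le_lintegral_pairing_add {α : Type*} [MeasurableSpace α] {μ : Measure α}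
    {P : ℝ} (hP : 0 < P) (hμ : μ Set.univ = ENNReal.ofReal P) {p : ℝ} (hp : 1 < p)
    {v : α → ℝ} (hv : Measurable v) (a : ℝ) :
    ENNReal.ofReal (P * |a| ^ p) ≤
      ENNReal.ofReal (2 / ((1 - 2 ^ (1 - p)) / 2)) * ∫⁻ y, ENNReal.ofReal (signedPairing p a (v y)) ∂μ
        + ENNReal.ofReal (4 ^ p * P ^ (1 - p)) * (∫⁻ y, ‖v y‖ₑ ∂μ) ^ p := by
  set c : ℝ := (1 - 2 ^ (1 - p)) / 2 with hc
  have hc0 : 0 < c := by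
    have : (2 : ℝ) ^ (1 - p) < 1 := Real.rpow_lt_one_of_one_lt_of_neg (by norm_num) (by linarith)
    rw [hc]; linarith
  set T : Set α := {y | |a| / 2 < |v y|} with hT
  have hTm : MeasurableSet T := measurableSet_lt measurable_const hv.abs
  have hsum : μ T + μ Tᶜ = ENNReal.ofReal P := by rw [measure_add_measure_compl hTm, hμ]
  rcases le_or_gt (ENNReal.ofReal (P / 2)) (μ T) with h | h
  · refine le_add_left ?_
    have h1 : ENNReal.ofReal (P * |a| / 4) ≤ ∫⁻ y, ‖v y‖ₑ ∂μ := by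
      calc ENNReal.ofReal (P * |a| / 4) = ENNReal.ofReal (|a| / 2) * ENNReal.ofReal (P / 2) := by
            rw [← ENNReal.ofReal_mul (by positivity)]; congr 1; ring
        _ ≤ ENNReal.ofReal (|a| / 2) * μ T := by gcongr
        _ = ∫⁻ _ in T, ENNReal.ofReal (|a| / 2) ∂μ := by rw [setLIntegral_const]
        _ ≤ ∫⁻ y in T, ‖v y‖ₑ ∂μ := by
            refine setLIntegral_mono' hTm fun y hy => ?_
            rw [Real.enorm_eq_ofReal_abs]
            exact ENNReal.ofReal_le_ofReal (le_of_lt hy)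
        _ ≤ ∫⁻ y, ‖v y‖ₑ ∂μ := setLIntegral_le_lintegral _ _
    calc ENNReal.ofReal (P * |a| ^ p)
        = ENNReal.ofReal (4 ^ p * P ^ (1 - p)) * ENNReal.ofReal (P * |a| / 4) ^ p := by
          rw [ENNReal.ofReal_rpow_of_nonneg (by positivity) (by linarith),
            ← ENNReal.ofReal_mul (by positivity), Real.div_rpow (by positivity) (by norm_num),
            Real.mul_rpow hP.le (abs_nonneg _), Real.rpow_sub hP, Real.rpow_one]
          congr 1
          have : (4 : ℝ) ^ p ≠ 0 := by positivity
          have : P ^ p ≠ 0 := by positivity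
          field_simp
      _ ≤ _ := by gcongr
  · refine le_add_right ?_
    have h1 : ENNReal.ofReal (P / 2) ≤ μ Tᶜ := by
      by_contra hcon
      have := ENNReal.add_lt_add h (not_le.1 hcon)
      rw [hsum, ← ENNReal.ofReal_add (by positivity) (by positivity), add_halves] at this
      exact lt_irrefl _ this
    calc ENNReal.ofReal (P * |a| ^ p)
        = ENNReal.ofReal (2 / c) * (ENNReal.ofReal (c * |a| ^ p) * ENNReal.ofReal (P / 2)) := by
          rw [← ENNReal.ofReal_mul (by positivity), ← ENNReal.ofReal_mul (by positivity)]
          congr 1; field_simp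
      _ ≤ ENNReal.ofReal (2 / c) * (ENNReal.ofReal (c * |a| ^ p) * μ Tᶜ) := by gcongr
      _ = ENNReal.ofReal (2 / c) * ∫⁻ _ in Tᶜ, ENNReal.ofReal (c * |a| ^ p) ∂μ := by
          rw [setLIntegral_const]
      _ ≤ ENNReal.ofReal (2 / c) * ∫⁻ y in Tᶜ, ENNReal.ofReal (signedPairing p a (v y)) ∂μ := by
          gcongr 1
          refine setLIntegral_mono' hTm.compl fun y hy => ENNReal.ofReal_le_ofReal ?_
          exact mul_abs_rpow_le_signedPairing hp (not_lt.1 hy)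
      _ ≤ _ := by gcongr; exact Measure.restrict_le_self

/-- The open annulus `{y : R < |x - y| < 2R}`. -/
def annulus {n : ℕ} (R : ℝ) (x : EuclideanSpace ℝ (Fin n)) : Set (EuclideanSpace ℝ (Fin n)) :=
  {y | R < ‖x - y‖ ∧ ‖x - y‖ < 2 * R}

lemma measurableSet_annulus_prod (n : ℕ) (R : ℝ) :
    MeasurableSet {z : EuclideanSpace ℝ (Fin n) × EuclideanSpace ℝ (Fin n) | z.2 ∈ annulus R z.1} :=
  ((isOpen_lt continuous_const (continuous_fst.sub continuous_snd).norm).inter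
    (isOpen_lt (continuous_fst.sub continuous_snd).norm continuous_const)).measurableSet

lemma measurableSet_annulus {n : ℕ} (R : ℝ) (x : EuclideanSpace ℝ (Fin n)) :
    MeasurableSet (annulus R x) :=
  ((isOpen_lt continuous_const (continuous_const.sub continuous_id).norm).inter
    (isOpen_lt (continuous_const.sub continuous_id).norm continuous_const)).measurableSet

lemma volume_annulus {n : ℕ} (hn : 1 ≤ n) : ∃ β : ℝ, 0 < β ∧ ∀ (R : ℝ), 0 < R →
    ∀ x : EuclideanSpace ℝ (Fin n), volume (annulus R x) = ENNReal.ofReal (β * R ^ n) := by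
  set ω : ℝ := volume.real (Metric.ball (0 : EuclideanSpace ℝ (Fin n)) 1) with hω
  have hω0 : 0 < ω := ENNReal.toReal_pos (Metric.measure_ball_pos _ _ one_pos).ne'
    measure_ball_lt_top.ne
  have : Nonempty (Fin n) := ⟨⟨0, by omega⟩⟩
  have h2 : (1 : ℝ) < 2 ^ n := one_lt_pow₀ (by norm_num) (by omega)
  refine ⟨(2 ^ n - 1) * ω, mul_pos (by linarith) hω0, fun R hR x => ?_⟩
  have hset : annulus R x = Metric.ball x (2 * R) \ Metric.closedBall x R := by
    ext y
    simp only [annulus, Set.mem_ofPred_eq, Set.mem_sdiff, Metric.mem_ball, Metric.mem_closedBall,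
      dist_comm y x, dist_eq_norm, not_le]
    exact and_comm
  have hωe : volume (Metric.ball (0 : EuclideanSpace ℝ (Fin n)) 1) = ENNReal.ofReal ω :=
    (ENNReal.ofReal_toReal measure_ball_lt_top.ne).symm
  rw [hset, measure_sdiff (Metric.closedBall_subset_ball (by linarith))
    measurableSet_closedBall.nullMeasurableSet measure_closedBall_lt_top.ne,
    Measure.addHaar_ball _ _ (by positivity), Measure.addHaar_closedBall _ _ hR.le, hωe,
    finrank_euclideanSpace_fin, ← ENNReal.ofReal_mul (by positivity),
    ← ENNReal.ofReal_mul (by positivity), ← ENNReal.ofReal_sub _ (by positivity)]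
  congr 1; rw [mul_pow]; ring

/-- The Nash inequality at a fixed scale `R`, for a kernel bounded below by `j` on the annuli of
radius `R`, whose volume is `P`. -/
lemma nash_lintegral {n : ℕ} {R P j p m : ℝ} (hP : 0 < P) (hj : 0 < j) (hp : 1 < p) (hm : 0 ≤ m)
    (hvol : ∀ x : EuclideanSpace ℝ (Fin n), volume (annulus R x) = ENNReal.ofReal P)
    {J : EuclideanSpace ℝ (Fin n) → EuclideanSpace ℝ (Fin n) → ℝ}
    (hJm : Measurable (Function.uncurry J))
    (hJ : ∀ x, ∀ y ∈ annulus R x, j ≤ J x y)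
    {v : EuclideanSpace ℝ (Fin n) → ℝ} (hv : Measurable v)
    (hvm : ∫⁻ x, ‖v x‖ₑ ≤ ENNReal.ofReal m) :
    ∫⁻ x, ENNReal.ofReal (P * |v x| ^ p) ≤
      ENNReal.ofReal (2 / ((1 - 2 ^ (1 - p)) / 2) / j) *
        (∫⁻ z : EuclideanSpace ℝ (Fin n) × EuclideanSpace ℝ (Fin n),
          ENNReal.ofReal (J z.1 z.2 * signedPairing p (v z.1) (v z.2)))
      + ENNReal.ofReal (4 ^ p * P ^ (1 - p) * m ^ (p - 1) * (P * m)) := by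
  set c' : ℝ := 2 / ((1 - 2 ^ (1 - p)) / 2) with hc'
  have hc'0 : 0 ≤ c' := by
    have : (2 : ℝ) ^ (1 - p) < 1 := Real.rpow_lt_one_of_one_lt_of_neg (by norm_num) (by linarith)
    rw [hc']; have : 0 < 1 - (2 : ℝ) ^ (1 - p) := by linarith
    positivity
  set I : EuclideanSpace ℝ (Fin n) → ℝ≥0∞ := fun x => ∫⁻ y in annulus R x, ‖v y‖ₑ with hI
  set F : EuclideanSpace ℝ (Fin n) × EuclideanSpace ℝ (Fin n) → ℝ≥0∞ := fun z => ENNReal.ofReal (J z.1 z.2 * signedPairing p (v z.1) (v z.2))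
    with hF
  have hFm : Measurable F := ENNReal.measurable_ofReal.comp
    (hJm.mul ((continuous_signedPairing hp).measurable.comp
      ((hv.comp measurable_fst).prodMk (hv.comp measurable_snd))))
  have hpt : ∀ x, ENNReal.ofReal (P * |v x| ^ p) ≤ ENNReal.ofReal (c' / j) * (∫⁻ y, F (x, y))
      + ENNReal.ofReal (4 ^ p * P ^ (1 - p) * m ^ (p - 1)) * I x := by
    intro x
    refine (mul_abs_rpow_le_lintegral_pairing_add (μ := volume.restrict (annulus R x)) hP
      (by rw [Measure.restrict_apply_univ, hvol]) hp hv (v x)).trans ?_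
    refine add_le_add ?_ ?_
    · rw [div_eq_mul_inv c' j, ENNReal.ofReal_mul hc'0, mul_assoc]
      gcongr 1
      rw [← lintegral_const_mul _ (show Measurable fun y => F (x, y) from
        hFm.comp measurable_prodMk_left)]
      refine le_trans ?_ (setLIntegral_le_lintegral (annulus R x) _)
      refine setLIntegral_mono' (measurableSet_annulus R x) fun y hy => ?_
      rw [hF, ← ENNReal.ofReal_mul (by positivity)]
      refine ENNReal.ofReal_le_ofReal ?_
      have h0 := signedPairing_nonneg hp (v x) (v y)
      calc signedPairing p (v x) (v y) = j⁻¹ * (j * signedPairing p (v x) (v y)) := by field_simp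
        _ ≤ j⁻¹ * (J x y * signedPairing p (v x) (v y)) := by gcongr; exact hJ x y hy
    · rw [ENNReal.ofReal_mul (p := 4 ^ p * P ^ (1 - p)) (by positivity), mul_assoc]
      gcongr 1
      have hIm : I x ≤ ENNReal.ofReal m := (setLIntegral_le_lintegral _ _).trans hvm
      have hpp : I x ^ p = I x ^ (p - 1) * I x := by
        conv_rhs => rw [← ENNReal.rpow_one (I x)]
        rw [← ENNReal.rpow_mul, ← ENNReal.rpow_add_of_nonneg _ _ (by linarith) zero_le_one]
        congr 1; ring
      change I x ^ p ≤ _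
      rw [hpp, ← ENNReal.ofReal_rpow_of_nonneg hm (by linarith)]
      gcongr
  have hIint : ∫⁻ x, I x ≤ ENNReal.ofReal (P * m) := by
    have h1 : ∀ x, I x = ∫⁻ y, (annulus R x).indicator (fun y => ‖v y‖ₑ) y := fun x =>
      (lintegral_indicator (measurableSet_annulus R x) _).symm
    have hmeas : Measurable (Function.uncurry fun (x y : EuclideanSpace ℝ (Fin n)) =>
        (annulus R x).indicator (fun y => ‖v y‖ₑ) y) := by
      have : (Function.uncurry fun (x y : EuclideanSpace ℝ (Fin n)) => (annulus R x).indicator (fun y => ‖v y‖ₑ) y) =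
          {z : EuclideanSpace ℝ (Fin n) × EuclideanSpace ℝ (Fin n) | z.2 ∈ annulus R z.1}.indicator fun z => ‖v z.2‖ₑ := by
        ext z; simp [Function.uncurry, Set.indicator]
      rw [this]
      exact (hv.comp measurable_snd).enorm.indicator (measurableSet_annulus_prod n R)
    simp_rw [h1]
    rw [lintegral_lintegral_swap hmeas.aemeasurable]
    have h2 : ∀ y : EuclideanSpace ℝ (Fin n), ∫⁻ x, (annulus R x).indicator (fun y => ‖v y‖ₑ) y
        = ‖v y‖ₑ * ENNReal.ofReal P := by
      intro y
      have : (fun x => (annulus R x).indicator (fun y => ‖v y‖ₑ) y) =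
          (annulus R y).indicator fun _ => ‖v y‖ₑ := by
        ext x
        by_cases h : R < ‖y - x‖ ∧ ‖y - x‖ < 2 * R <;>
          simp [annulus, norm_sub_rev x y, h]
      rw [this, lintegral_indicator (measurableSet_annulus R y), setLIntegral_const, hvol]
    simp_rw [h2]
    rw [lintegral_mul_const _ hv.enorm, mul_comm P m, ENNReal.ofReal_mul hm]
    gcongr
  have hFint : Measurable fun x => ∫⁻ y, F (x, y) := hFm.lintegral_prod_right'
  calc ∫⁻ x, ENNReal.ofReal (P * |v x| ^ p)
      ≤ ∫⁻ x, (ENNReal.ofReal (c' / j) * (∫⁻ y, F (x, y))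
        + ENNReal.ofReal (4 ^ p * P ^ (1 - p) * m ^ (p - 1)) * I x) := lintegral_mono hpt
    _ = ENNReal.ofReal (c' / j) * (∫⁻ x, ∫⁻ y, F (x, y))
        + ENNReal.ofReal (4 ^ p * P ^ (1 - p) * m ^ (p - 1)) * ∫⁻ x, I x := by
        rw [lintegral_add_left (hFint.const_mul _), lintegral_const_mul _ hFint,
          lintegral_const_mul' _ _ ENNReal.ofReal_ne_top]
    _ ≤ _ := by
        rw [Measure.volume_eq_prod, lintegral_prod _ hFm.aemeasurable,
          ENNReal.ofReal_mul (p := 4 ^ p * P ^ (1 - p) * m ^ (p - 1)) (by positivity)]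
        gcongr

/-- **Nash inequality at large scales.** Since `J` is bounded below only off the diagonal, the
inequality is available only for scales `R ≥ 1`. -/
lemma nash_inequality {n : ℕ} (hn : 1 ≤ n) {σ c₁ p : ℝ} (hc₁ : 0 < c₁) (hσ : 0 < σ) (hp : 1 < p) :
    ∃ κ A : ℝ, 0 < κ ∧ 0 < A ∧
      ∀ J : EuclideanSpace ℝ (Fin n) → EuclideanSpace ℝ (Fin n) → ℝ, IsFatTailKernel n σ c₁ J →
      ∀ v : EuclideanSpace ℝ (Fin n) → ℝ, Measurable v → Integrable v →
      Integrable (fun x => |v x| ^ p) →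
      Integrable (fun z : EuclideanSpace ℝ (Fin n) × EuclideanSpace ℝ (Fin n) =>
        J z.1 z.2 * signedPairing p (v z.1) (v z.2)) →
      ∀ m R : ℝ, ∫ x, |v x| ≤ m → 1 ≤ R →
        κ * R ^ (-(2 * σ)) * ((∫ x, |v x| ^ p) - A * R ^ (-((n : ℝ) * (p - 1))) * m ^ p) ≤
          ∫ z : EuclideanSpace ℝ (Fin n) × EuclideanSpace ℝ (Fin n),
            J z.1 z.2 * signedPairing p (v z.1) (v z.2) := by
  obtain ⟨β, hβ, hvol⟩ := volume_annulus (n := n) hn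
  set c' : ℝ := 2 / ((1 - 2 ^ (1 - p)) / 2) with hc'
  have hc'0 : 0 < c' := by
    have : (2 : ℝ) ^ (1 - p) < 1 := Real.rpow_lt_one_of_one_lt_of_neg (by norm_num) (by linarith)
    rw [hc']; have : 0 < 1 - (2 : ℝ) ^ (1 - p) := by linarith
    positivity
  refine ⟨c₁ * 2 ^ (-((n : ℝ) + 2 * σ)) * β / c', 4 ^ p * β ^ (1 - p), by positivity,
    by positivity, ?_⟩
  intro J hJ v hv hvi hvp hint m R hm hR
  have hR0 : 0 < R := by linarith
  have hm0 : 0 ≤ m := (integral_nonneg fun x => abs_nonneg _).trans hm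
  set P : ℝ := β * R ^ n with hP
  set j : ℝ := c₁ * (2 * R) ^ (-((n : ℝ) + 2 * σ)) with hj
  have hP0 : 0 < P := by positivity
  have hj0 : 0 < j := by positivity
  have hJj : ∀ x, ∀ y ∈ annulus R x, j ≤ J x y := by
    intro x y hy
    refine le_trans ?_ (hJ.tail x y (lt_of_le_of_lt hR hy.1))
    refine mul_le_mul_of_nonneg_left ?_ hc₁.le
    exact Real.rpow_le_rpow_of_nonpos (by linarith [hy.1]) hy.2.le (by
      have : (0 : ℝ) ≤ n := Nat.cast_nonneg n
      linarith)
  have hvm : ∫⁻ x, ‖v x‖ₑ ≤ ENNReal.ofReal m := by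
    rw [← ofReal_integral_norm_eq_lintegral_enorm hvi]
    exact ENNReal.ofReal_le_ofReal hm
  have key := nash_lintegral (p := p) hP0 hj0 hp hm0 (fun x => hvol R hR0 x)
    hJ.continuous.measurable hJj hv hvm
  rw [← hc', ← ofReal_integral_eq_lintegral_ofReal (hvp.const_mul P)
      (Eventually.of_forall fun x => by positivity),
    ← ofReal_integral_eq_lintegral_ofReal hint (Eventually.of_forall fun z =>
      mul_nonneg (hJ.nonneg _ _) (signedPairing_nonneg hp _ _)), integral_const_mul,
    ← ENNReal.ofReal_mul (by positivity)] at key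
  set D : ℝ := ∫ z : EuclideanSpace ℝ (Fin n) × EuclideanSpace ℝ (Fin n),
            J z.1 z.2 * signedPairing p (v z.1) (v z.2) with hD
  have hD0 : 0 ≤ D := integral_nonneg fun z =>
    mul_nonneg (hJ.nonneg _ _) (signedPairing_nonneg hp _ _)
  rw [← ENNReal.ofReal_add (by positivity) (by positivity),
    ENNReal.ofReal_le_ofReal_iff (by positivity)] at key
  set Y : ℝ := ∫ x, |v x| ^ p with hY
  have hmp : m ^ (p - 1) * m = m ^ p := by
    rcases hm0.eq_or_lt with h | h
    · rw [← h, Real.zero_rpow (by linarith), Real.zero_rpow (by linarith), zero_mul]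
    · rw [← Real.rpow_add_one h.ne']; ring_nf
  have hPp : P ^ (1 - p) = β ^ (1 - p) * R ^ (-((n : ℝ) * (p - 1))) := by
    rw [hP, Real.mul_rpow hβ.le (by positivity), ← Real.rpow_natCast, ← Real.rpow_mul hR0.le]
    ring_nf
  have hjP : c₁ * 2 ^ (-((n : ℝ) + 2 * σ)) * β / c' * R ^ (-(2 * σ)) = j * P / c' := by
    have : R ^ (-((n : ℝ) + 2 * σ)) * R ^ n = R ^ (-(2 * σ)) := by
      rw [← Real.rpow_natCast, ← Real.rpow_add hR0]; ring_nf
    rw [hj, hP, Real.mul_rpow (by norm_num) hR0.le, ← this]; ring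
  have h1 : P * (Y - 4 ^ p * β ^ (1 - p) * R ^ (-((n : ℝ) * (p - 1))) * m ^ p) ≤ c' / j * D := by
    have : 4 ^ p * P ^ (1 - p) * m ^ (p - 1) * (P * m)
        = P * (4 ^ p * β ^ (1 - p) * R ^ (-((n : ℝ) * (p - 1))) * m ^ p) := by
      rw [← hmp, hPp]; ring
    rw [this] at key
    linarith
  rw [hjP]
  calc j * P / c' * (Y - 4 ^ p * β ^ (1 - p) * R ^ (-((n : ℝ) * (p - 1))) * m ^ p)
      = j / c' * (P * (Y - 4 ^ p * β ^ (1 - p) * R ^ (-((n : ℝ) * (p - 1))) * m ^ p)) := by ring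
    _ ≤ j / c' * (c' / j * D) := by gcongr
    _ = D := by field_simp

/-! ### The dissipation inequality for a truncated power -/

section Dissipation

variable {n : ℕ} {σ c₁ : ℝ} {J : EuclideanSpace ℝ (Fin n) → EuclideanSpace ℝ (Fin n) → ℝ}

namespace IsFatTailKernel

lemma integrable_right (hJ : IsFatTailKernel n σ c₁ J) (x : EuclideanSpace ℝ (Fin n)) :
    Integrable (fun y => J x y) := by
  simpa only [hJ.symm x] using hJ.integrable x

lemma measurable_integral (hJ : IsFatTailKernel n σ c₁ J) : Measurable fun x => ∫ y, J x y :=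
  (StronglyMeasurable.integral_prod_right (f := J)
    hJ.continuous.measurable.stronglyMeasurable).measurable

lemma integrable_mul (hJ : IsFatTailKernel n σ c₁ J) {f : EuclideanSpace ℝ (Fin n) → ℝ}
    (hf : Integrable f) (x : EuclideanSpace ℝ (Fin n)) : Integrable fun y => J x y * f y := by
  obtain ⟨M, hM⟩ := hJ.bounded
  refine hf.bdd_mul (c := M) (hJ.integrable_right x).aestronglyMeasurable
    (Eventually.of_forall fun y => ?_)
  rw [Real.norm_of_nonneg (hJ.nonneg x y)]
  exact hM x y

/-- The gain and the loss parts of the jump term converge separately. -/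
lemma integral_mul_sub (hJ : IsFatTailKernel n σ c₁ J) {f : EuclideanSpace ℝ (Fin n) → ℝ}
    (hf : Integrable f) (x : EuclideanSpace ℝ (Fin n)) (a : ℝ) :
    ∫ y, J x y * (f y - a) = (∫ y, J x y * f y) - (∫ y, J x y) * a := by
  simp_rw [mul_sub]
  rw [integral_sub (hJ.integrable_mul hf x) ((hJ.integrable_right x).mul_const a),
    integral_mul_const]

end IsFatTailKernel

/-- Pointwise form of the dissipation inequality, symmetrised in `x` and `y`. When exactly one point lies
in `K`, the diagonal term has the good sign and only the mass of `f` off `K` is left as an error. -/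
lemma indicator_softThreshold_pairing {α : Type*} {p ε : ℝ} (hp : 1 < p) (hε : 0 < ε) (K : Set α)
    (f : α → ℝ) (x y : α) :
    signedPairing p (K.indicator (fun x => softThreshold ε (f x)) x)
        (K.indicator (fun x => softThreshold ε (f x)) y)
      ≤ -(signedPow p (K.indicator (fun x => softThreshold ε (f x)) x) * (f y - f x)
          + signedPow p (K.indicator (fun x => softThreshold ε (f x)) y) * (f x - f y))
        + (|signedPow p (K.indicator (fun x => softThreshold ε (f x)) x)|
            * Kᶜ.indicator (fun x => |f x|) y
          + |signedPow p (K.indicator (fun x => softThreshold ε (f x)) y)|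
            * Kᶜ.indicator (fun x => |f x|) x) := by
  have hmul : ∀ a b : ℝ, a * b ≤ |a| * |b| := fun a b => (le_abs_self _).trans (abs_mul a b).le
  by_cases hx : x ∈ K <;> by_cases hy : y ∈ K
  · have := signedPow_softThreshold_pairing hp hε (f x) (f y)
    simp only [Set.indicator_of_mem, hx, hy, Set.mem_compl_iff, not_true, not_false_eq_true,
      Set.indicator_of_notMem]
    linarith
  · have h1 := signedPow_softThreshold_mul_self hp hε (f x)
    have h2 := hmul (signedPow p (softThreshold ε (f x))) (f y)
    simp only [Set.indicator_of_mem, hx, hy, Set.mem_compl_iff, not_true, not_false_eq_true,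
      Set.indicator_of_notMem, signedPairing, signedPow_zero hp]
    linarith
  · have h1 := signedPow_softThreshold_mul_self hp hε (f y)
    have h2 := hmul (signedPow p (softThreshold ε (f y))) (f x)
    simp only [Set.indicator_of_mem, hx, hy, Set.mem_compl_iff, not_true, not_false_eq_true,
      Set.indicator_of_notMem, signedPairing, signedPow_zero hp]
    linarith
  · simp [Set.indicator_of_notMem, hx, hy, signedPairing, signedPow_zero hp]

/-- **Dissipation inequality.** On a set `K` where the total jump rate `∫ J x y dy` is bounded by `N`,
the rate of change of the truncated power is bounded by minus the dissipation of the truncation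
`v` set to zero off `K`, up to an error which is small when `K` carries most of the mass of `f`.
That error is finite only because `J` is bounded and the truncated power vanishes near `0`. -/
lemma setIntegral_signedPow_mul_le (hJ : IsFatTailKernel n σ c₁ J) {M : ℝ} (hM : ∀ x y, J x y ≤ M)
    {p ε B N : ℝ} (hp : 1 < p) (hε : 0 < ε) {f : EuclideanSpace ℝ (Fin n) → ℝ} (hf : Measurable f)
    (hfi : Integrable f) (hB0 : 0 ≤ B) (hB : ∀ᵐ x, |f x| ≤ B) {K : Set (EuclideanSpace ℝ (Fin n))}
    (hK : MeasurableSet K) (hN0 : 0 ≤ N) (hN : ∀ x ∈ K, ∫ y, J x y ≤ N)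
    {v : EuclideanSpace ℝ (Fin n) → ℝ} (hv : v = K.indicator fun x => softThreshold ε (f x)) :
    Integrable (fun z : EuclideanSpace ℝ (Fin n) × EuclideanSpace ℝ (Fin n) =>
      J z.1 z.2 * signedPairing p (v z.1) (v z.2)) ∧
    ∫ x in K, signedPow p (softThreshold ε (f x)) * ∫ y, J x y * (f y - f x) ≤
      -(1 / 2) * (∫ z : EuclideanSpace ℝ (Fin n) × EuclideanSpace ℝ (Fin n),
        J z.1 z.2 * signedPairing p (v z.1) (v z.2))
      + M * (B ^ (p - 1) / ε * ∫ x, |f x|) * ∫ x in Kᶜ, |f x| := by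
  have hM0 : 0 ≤ M := (hJ.nonneg 0 0).trans (hM 0 0)
  set C : ℝ := B ^ (p - 1) / ε with hC
  have hC0 : 0 ≤ C := by positivity
  have hvm : Measurable v := by
    rw [hv]; exact ((continuous_softThreshold ε).measurable.comp hf).indicator hK
  set ψ : EuclideanSpace ℝ (Fin n) → ℝ := fun x => signedPow p (v x) with hψ
  have hψm : Measurable ψ := (continuous_signedPow hp).measurable.comp hvm
  have hψK : ∀ x ∈ K, ψ x = signedPow p (softThreshold ε (f x)) := fun x hx => by
    simp [hψ, hv, hx]
  have hψK' : ∀ x ∉ K, ψ x = 0 := fun x hx => by simp [hψ, hv, hx, signedPow_zero hp]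
  have hψle : ∀ᵐ x, |ψ x| ≤ C * |f x| := by
    filter_upwards [hB] with x hx
    by_cases hxK : x ∈ K
    · rw [hψK x hxK]; exact abs_signedPow_softThreshold_le hp hε hx
    · rw [hψK' x hxK, abs_zero]; positivity
  have hψi : Integrable ψ := (hfi.abs.const_mul C).mono' hψm.aestronglyMeasurable hψle
  have hJm : Measurable fun z : EuclideanSpace ℝ (Fin n) × EuclideanSpace ℝ (Fin n) =>
    J z.1 z.2 := hJ.continuous.measurable
  have hJb : ∀ z : EuclideanSpace ℝ (Fin n) × EuclideanSpace ℝ (Fin n), ‖J z.1 z.2‖ ≤ M := fun z => by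
    rw [Real.norm_of_nonneg (hJ.nonneg _ _)]; exact hM _ _
  have hfm1 : Measurable fun z : EuclideanSpace ℝ (Fin n) × EuclideanSpace ℝ (Fin n) => f z.1 :=
    hf.comp measurable_fst
  have hψm1 : Measurable fun z : EuclideanSpace ℝ (Fin n) × EuclideanSpace ℝ (Fin n) => ψ z.1 :=
    hψm.comp measurable_fst
  set H : EuclideanSpace ℝ (Fin n) × EuclideanSpace ℝ (Fin n) → ℝ := fun z =>
    J z.1 z.2 * (ψ z.1 * (f z.2 - f z.1)) with hH
  have hH1 : Integrable fun z : EuclideanSpace ℝ (Fin n) × EuclideanSpace ℝ (Fin n) =>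
      J z.1 z.2 * (ψ z.1 * f z.2) :=
    (hψi.mul_prod hfi).bdd_mul hJm.aestronglyMeasurable (Eventually.of_forall hJb)
  have hH2 : Integrable fun z : EuclideanSpace ℝ (Fin n) × EuclideanSpace ℝ (Fin n) =>
      J z.1 z.2 * (ψ z.1 * f z.1) := by
    have hmeas := (hJm.mul (hψm1.mul hfm1)).aestronglyMeasurable
      (μ := (volume : Measure (EuclideanSpace ℝ (Fin n) × EuclideanSpace ℝ (Fin n))))
    rw [Measure.volume_eq_prod] at hmeas ⊢
    refine (integrable_prod_iff hmeas).2 ⟨Eventually.of_forall fun x =>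
      (hJ.integrable_right x).mul_const (ψ x * f x), ?_⟩
    have heq : (fun x => ∫ y, ‖J x y * (ψ x * f x)‖) = fun x => (∫ y, J x y) * |ψ x * f x| := by
      ext x
      simp_rw [norm_mul (J x _), Real.norm_of_nonneg (hJ.nonneg x _), Real.norm_eq_abs]
      rw [integral_mul_const]
    change Integrable (fun x => ∫ y, ‖J x y * (ψ x * f x)‖) volume
    rw [heq]
    refine ((hfi.abs.const_mul (N * (C * B)))).mono'
      (hJ.measurable_integral.mul (hψm.mul hf).abs).aestronglyMeasurable ?_
    filter_upwards [hB, hψle] with x hx hx2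
    rw [norm_mul, Real.norm_of_nonneg (integral_nonneg fun y => hJ.nonneg x y), Real.norm_eq_abs,
      abs_abs]
    by_cases hxK : x ∈ K
    · calc (∫ y, J x y) * |ψ x * f x| ≤ N * ((C * |f x|) * B) := by
            rw [abs_mul]
            gcongr
            exact hN x hxK
        _ = N * (C * B) * |f x| := by ring
    · rw [hψK' x hxK, zero_mul, abs_zero, mul_zero]; positivity
  have hHi : Integrable H := by
    refine (hH1.sub hH2).congr (Eventually.of_forall fun z => ?_)
    simp only [hH, Pi.sub_apply]; ring
  have hHint : ∫ z, H z = ∫ x in K, signedPow p (softThreshold ε (f x)) *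
      ∫ y, J x y * (f y - f x) := by
    rw [Measure.volume_eq_prod] at hHi ⊢
    rw [integral_prod _ hHi, ← integral_indicator hK]
    refine integral_congr_ae (Eventually.of_forall fun x => ?_)
    by_cases hxK : x ∈ K
    · simp only [hH, Set.indicator_of_mem hxK, ← hψK x hxK]
      rw [← integral_const_mul]
      exact integral_congr_ae (Eventually.of_forall fun y => by ring)
    · simp [hH, hxK, hψK' x hxK]
  set e : EuclideanSpace ℝ (Fin n) × EuclideanSpace ℝ (Fin n) → ℝ := fun z =>
    |ψ z.1| * Kᶜ.indicator (fun x => |f x|) z.2 with he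
  have hei : Integrable e := hψi.abs.mul_prod (hfi.abs.indicator hK.compl)
  have he0 : ∀ z, 0 ≤ e z := fun z =>
    mul_nonneg (abs_nonneg _) (Set.indicator_nonneg (fun _ _ => abs_nonneg _) _)
  have heint : ∫ z, e z = (∫ x, |ψ x|) * ∫ x in Kᶜ, |f x| := by
    rw [← integral_indicator hK.compl, Measure.volume_eq_prod]
    exact integral_prod_mul (μ := volume) (ν := volume) (fun x => |ψ x|)
      (Kᶜ.indicator fun x => |f x|)
  have hψint : ∫ x, |ψ x| ≤ C * ∫ x, |f x| := by
    rw [← integral_const_mul]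
    exact integral_mono_ae hψi.abs (hfi.abs.const_mul C) hψle
  have hswap : ∀ g : EuclideanSpace ℝ (Fin n) × EuclideanSpace ℝ (Fin n) → ℝ,
      ∫ z, g (Prod.swap z) = ∫ z, g z := fun g => by
    rw [Measure.volume_eq_prod]; exact integral_prod_swap g
  have hswapi : ∀ g : EuclideanSpace ℝ (Fin n) × EuclideanSpace ℝ (Fin n) → ℝ, Integrable g →
      Integrable fun z => g (Prod.swap z) := fun g hg => by
    rw [Measure.volume_eq_prod] at hg ⊢; exact hg.swap
  set G : EuclideanSpace ℝ (Fin n) × EuclideanSpace ℝ (Fin n) → ℝ := fun z =>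
    J z.1 z.2 * signedPairing p (v z.1) (v z.2) with hG
  have hGle : ∀ z, G z ≤ -(H z + H z.swap) + M * (e z + e z.swap) := by
    intro z
    have h1 := indicator_softThreshold_pairing hp hε K f z.1 z.2
    rw [← hv] at h1
    have h2 := mul_le_mul_of_nonneg_left h1 (hJ.nonneg z.1 z.2)
    have h3 := mul_le_mul_of_nonneg_right (hM z.1 z.2) (add_nonneg (he0 z) (he0 z.swap))
    simp only [hG, hH, he, hψ, Prod.fst_swap, Prod.snd_swap, hJ.symm z.2 z.1] at h2 h3 ⊢
    linarith
  have hHs : Integrable fun z : EuclideanSpace ℝ (Fin n) × EuclideanSpace ℝ (Fin n) =>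
      H z + H z.swap := hHi.add (hswapi H hHi)
  have hes : Integrable fun z : EuclideanSpace ℝ (Fin n) × EuclideanSpace ℝ (Fin n) =>
      e z + e z.swap := hei.add (hswapi e hei)
  have hHs' : Integrable fun z : EuclideanSpace ℝ (Fin n) × EuclideanSpace ℝ (Fin n) =>
      -(H z + H z.swap) := hHs.neg
  have hRi : Integrable fun z : EuclideanSpace ℝ (Fin n) × EuclideanSpace ℝ (Fin n) =>
      -(H z + H z.swap) + M * (e z + e z.swap) :=
    hHs'.add (hes.const_mul M)
  have hGi : Integrable G := by
    refine hRi.mono' (hJm.mul ((continuous_signedPairing hp).measurable.comp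
      ((hvm.comp measurable_fst).prodMk (hvm.comp measurable_snd)))).aestronglyMeasurable
      (Eventually.of_forall fun z => ?_)
    rw [Real.norm_of_nonneg (mul_nonneg (hJ.nonneg _ _) (signedPairing_nonneg hp _ _))]
    exact hGle z
  refine ⟨hGi, ?_⟩
  have hle := integral_mono hGi hRi hGle
  rw [integral_add hHs' (hes.const_mul M),
    integral_neg, integral_const_mul, integral_add hHi (hswapi H hHi),
    integral_add hei (hswapi e hei), hswap, hswap, heint] at hle
  rw [← hHint]
  have h4 : M * ((∫ x, |ψ x|) * ∫ x in Kᶜ, |f x|) ≤ M * (C * ∫ x, |f x|) * ∫ x in Kᶜ, |f x| := by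
    rw [mul_assoc M]
    have : 0 ≤ ∫ x in Kᶜ, |f x| := integral_nonneg fun x => abs_nonneg _
    gcongr
  linarith

end Dissipation

/-! ### Evolution of the truncated power -/

/-- A Grönwall inequality with relaxation level `b` and a constant error `e`. -/
lemma le_exp_mul_add_of_hasDerivAt_le {y y' : ℝ → ℝ} {a b e s t : ℝ} (ha : 0 ≤ a) (hb : 0 ≤ b)
    (he : 0 ≤ e) (hst : s ≤ t) (hc : ContinuousOn y (Set.Icc s t))
    (hd : ∀ τ ∈ Set.Ioo s t, HasDerivAt y (y' τ) τ)
    (hle : ∀ τ ∈ Set.Ioo s t, y' τ ≤ -a * (y τ - b) + e) :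
    y t ≤ Real.exp (-a * (t - s)) * y s + b + e * (t - s) := by
  set z : ℝ → ℝ := fun τ => Real.exp (a * τ) * (y τ - b) - e * Real.exp (a * t) * τ with hz
  have hzd : ∀ τ ∈ Set.Ioo s t, HasDerivAt z (Real.exp (a * τ) * a * (y τ - b) +
      Real.exp (a * τ) * y' τ - e * Real.exp (a * t)) τ := by
    intro τ hτ
    have h1 : HasDerivAt (fun τ => Real.exp (a * τ)) (Real.exp (a * τ) * a) τ := by
      simpa using ((hasDerivAt_id τ).const_mul a).exp
    refine ((h1.mul ((hd τ hτ).sub_const b)).sub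
      ((hasDerivAt_id τ).const_mul (e * Real.exp (a * t)))).congr_deriv ?_
    ring
  have hanti : AntitoneOn z (Set.Icc s t) := by
    refine antitoneOn_of_deriv_nonpos (convex_Icc s t) ?_ ?_ ?_
    · exact ((Real.continuous_exp.comp (continuous_const.mul continuous_id)).continuousOn.mul
        (hc.sub continuousOn_const)).sub (continuous_const.mul continuous_id).continuousOn
    · rw [interior_Icc]
      exact fun τ hτ => (hzd τ hτ).differentiableAt.differentiableWithinAt
    · rw [interior_Icc]
      intro τ hτ
      rw [(hzd τ hτ).deriv]
      have h1 := mul_le_mul_of_nonneg_left (hle τ hτ) (Real.exp_pos (a * τ)).le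
      have h2 : Real.exp (a * τ) ≤ Real.exp (a * t) :=
        Real.exp_le_exp.2 (mul_le_mul_of_nonneg_left hτ.2.le ha)
      have h3 := mul_le_mul_of_nonneg_left h2 he
      linarith
  have h := hanti (Set.left_mem_Icc.2 hst) (Set.right_mem_Icc.2 hst) hst
  simp only [hz] at h
  have hexp : Real.exp (-a * (t - s)) * Real.exp (a * t) = Real.exp (a * s) := by
    rw [← Real.exp_add]; ring_nf
  have hpos := Real.exp_pos (a * t)
  have h4 : Real.exp (a * t) * y t ≤
      Real.exp (a * t) * (Real.exp (-a * (t - s)) * y s + b + e * (t - s)) := by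
    have h5 : 0 ≤ Real.exp (a * s) * b := by positivity
    have h6 : Real.exp (a * t) * (Real.exp (-a * (t - s)) * y s) = Real.exp (a * s) * y s := by
      rw [← hexp]; ring
    rw [mul_add, mul_add, h6]
    linarith
  exact le_of_mul_le_mul_left h4 hpos

section Evolution

variable {n : ℕ} {σ c₁ : ℝ} {J : EuclideanSpace ℝ (Fin n) → EuclideanSpace ℝ (Fin n) → ℝ}
  {u₀ : EuclideanSpace ℝ (Fin n) → ℝ} {u : ℝ → EuclideanSpace ℝ (Fin n) → ℝ}

namespace IsNonlocalHeatSolution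

lemma integrable (hu : IsNonlocalHeatSolution J u₀ u) {t : ℝ} (ht : 0 ≤ t) : Integrable (u t) :=
  memLp_one_iff_integrable.1 (hu.memLp_one t ht)

/-- A real-valued essential bound valid on a bounded time interval. -/
lemma exists_ae_bound (hu : IsNonlocalHeatSolution J u₀ u) (T : ℝ) :
    ∃ B : ℝ, 0 ≤ B ∧ ∀ t, 0 ≤ t → t ≤ T → ∀ᵐ x, |u t x| ≤ B := by
  obtain ⟨M, hM⟩ := hu.bounded_Linfty T
  refine ⟨M, M.2, fun t ht htT => ?_⟩
  have h := hM t ht htT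
  rw [eLpNorm_exponent_top] at h
  filter_upwards [ae_le_eLpNormEssSup (f := u t) (μ := volume)] with x hx
  have := hx.trans h
  rw [← ofReal_norm] at this
  have h2 := ENNReal.toReal_mono ENNReal.coe_ne_top this
  rwa [ENNReal.toReal_ofReal (norm_nonneg _)] at h2

/-- Pointwise continuity in time makes the a.e. bound uniform: the exceptional null set may be
taken independent of time. -/
lemma ae_forall_bound (hu : IsNonlocalHeatSolution J u₀ u) {T B : ℝ}
    (hB : ∀ t, 0 ≤ t → t ≤ T → ∀ᵐ x, |u t x| ≤ B) :
    ∀ᵐ x, ∀ t ∈ Set.Ioo 0 T, |u t x| ≤ B := by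
  have h1 : ∀ᵐ x, ∀ r : ℚ, (r : ℝ) ∈ Set.Ioo 0 T → |u r x| ≤ B := by
    refine ae_all_iff.2 fun r => ?_
    by_cases hr : (r : ℝ) ∈ Set.Ioo 0 T
    · filter_upwards [hB r hr.1.le hr.2.le] with x hx _ using hx
    · exact Eventually.of_forall fun x h => absurd h hr
  filter_upwards [h1, hu.equation] with x hx heq t ht
  by_contra! hcon
  have hcont : ContinuousAt (fun s => |u s x|) t := (heq t ht.1).continuousAt.abs
  have hev := (hcont.eventually (lt_mem_nhds hcon)).and (Ioo_mem_nhds ht.1 ht.2)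
  obtain ⟨l, r, hlr, hsub⟩ := mem_nhds_iff_exists_Ioo_subset.1 hev
  obtain ⟨q, hq⟩ := exists_rat_btwn (hlr.1.trans hlr.2)
  have := hsub ⟨hq.1, hq.2⟩
  exact absurd (hx q this.2) (not_le.2 this.1)

lemma tendsto_integral_abs_sub (hu : IsNonlocalHeatSolution J u₀ u) {t : ℝ} (ht : 0 ≤ t) :
    Tendsto (fun s => ∫ x, |u s x - u t x|) (𝓝[Set.Ici 0] t) (𝓝 0) := by
  have h := (ENNReal.tendsto_toReal ENNReal.zero_ne_top).comp (hu.continuous_L1 t ht)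
  refine (h.congr' ?_)
  filter_upwards [self_mem_nhdsWithin] with s hs
  simp only [Function.comp]
  rw [eLpNorm_one_eq_lintegral_enorm,
    ← ofReal_integral_norm_eq_lintegral_enorm ((hu.integrable hs).sub (hu.integrable ht)),
    ENNReal.toReal_ofReal (integral_nonneg fun x => norm_nonneg _)]
  rfl

lemma integrable_comp (hu : IsNonlocalHeatSolution J u₀ u) {T B L : ℝ}
    (hB : ∀ t, 0 ≤ t → t ≤ T → ∀ᵐ x, |u t x| ≤ B) {Ψ : ℝ → ℝ} (hΨc : Continuous Ψ) (hΨ0 : Ψ 0 = 0)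
    (hB0 : 0 ≤ B) (hΨ : ∀ a b, |a| ≤ B → |b| ≤ B → |Ψ a - Ψ b| ≤ L * |a - b|)
    {t : ℝ} (ht : t ∈ Set.Icc 0 T) : Integrable fun x => Ψ (u t x) := by
  refine ((hu.integrable ht.1).abs.const_mul L).mono'
    (hΨc.comp_aestronglyMeasurable (hu.integrable ht.1).aestronglyMeasurable) ?_
  filter_upwards [hB t ht.1 ht.2] with x hx
  simpa [hΨ0] using hΨ (u t x) 0 hx (by simpa using hB0)

lemma continuousOn_setIntegral_comp (hu : IsNonlocalHeatSolution J u₀ u) {T B L : ℝ}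
    (hB : ∀ t, 0 ≤ t → t ≤ T → ∀ᵐ x, |u t x| ≤ B) {Ψ : ℝ → ℝ} (hΨc : Continuous Ψ) (hΨ0 : Ψ 0 = 0)
    (hB0 : 0 ≤ B) (hΨ : ∀ a b, |a| ≤ B → |b| ≤ B → |Ψ a - Ψ b| ≤ L * |a - b|)
    (S : Set (EuclideanSpace ℝ (Fin n))) :
    ContinuousOn (fun t => ∫ x in S, Ψ (u t x)) (Set.Icc 0 T) := by
  intro t ht
  have hI := fun {t} => hu.integrable_comp hB hΨc hΨ0 hB0 hΨ (t := t)
  have h0 : Tendsto (fun s => L * ∫ x, |u s x - u t x|) (𝓝[Set.Icc 0 T] t) (𝓝 0) := by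
    simpa using ((hu.tendsto_integral_abs_sub ht.1).mono_left
      (nhdsWithin_mono t Set.Icc_subset_Ici_self)).const_mul L
  refine tendsto_iff_norm_sub_tendsto_zero.2 (squeeze_zero' (Eventually.of_forall fun s =>
    norm_nonneg _) ?_ h0)
  filter_upwards [self_mem_nhdsWithin] with s hs
  rw [← integral_sub (hI hs).integrableOn (hI ht).integrableOn]
  have hsub : Integrable fun x => |u s x - u t x| :=
    ((hu.integrable hs.1).sub (hu.integrable ht.1)).abs
  calc ‖∫ x in S, (Ψ (u s x) - Ψ (u t x))‖ ≤ ∫ x in S, ‖Ψ (u s x) - Ψ (u t x)‖ :=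
        norm_integral_le_integral_norm _
    _ ≤ ∫ x, ‖Ψ (u s x) - Ψ (u t x)‖ :=
        setIntegral_le_integral ((hI hs).sub (hI ht)).norm
          (Eventually.of_forall fun x => norm_nonneg _)
    _ ≤ ∫ x, L * |u s x - u t x| := by
        refine integral_mono_ae ((hI hs).sub (hI ht)).norm (hsub.const_mul L) ?_
        filter_upwards [hB s hs.1 hs.2, hB t ht.1 ht.2] with x hx hx' using hΨ _ _ hx hx'
    _ = L * ∫ x, |u s x - u t x| := integral_const_mul _ _

lemma continuousOn_setIntegral_abs (hu : IsNonlocalHeatSolution J u₀ u) (T : ℝ)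
    (S : Set (EuclideanSpace ℝ (Fin n))) :
    ContinuousOn (fun t => ∫ x in S, |u t x|) (Set.Icc 0 T) := by
  obtain ⟨B, hB0, hB⟩ := hu.exists_ae_bound T
  exact hu.continuousOn_setIntegral_comp (L := 1) hB continuous_abs abs_zero hB0
    (fun a b _ _ => by rw [one_mul]; exact abs_abs_sub_abs_le_abs_sub a b) S

lemma exists_integral_abs_bound (hu : IsNonlocalHeatSolution J u₀ u) (T : ℝ) :
    ∃ L : ℝ, 0 ≤ L ∧ ∀ t ∈ Set.Icc 0 T, ∫ x, |u t x| ≤ L := by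
  obtain ⟨L, hL⟩ := isCompact_Icc.bddAbove_image (hu.continuousOn_setIntegral_abs T Set.univ)
  refine ⟨max L 0, le_max_right _ _, fun t ht => le_max_of_le_left ?_⟩
  simpa using hL (Set.mem_image_of_mem _ ht)

/-- On a set of finite measure with bounded jump rate, the equation may be integrated: the jump term is
bounded there locally uniformly in time, so differentiation under the integral is justified. -/
lemma hasDerivAt_setIntegral (hJ : IsFatTailKernel n σ c₁ J) (hu : IsNonlocalHeatSolution J u₀ u)
    {p ε : ℝ} (hp : 1 < p) (hε : 0 < ε) {K : Set (EuclideanSpace ℝ (Fin n))}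
    (hK : MeasurableSet K) (hKfin : volume K ≠ ∞) {N : ℝ} (hN0 : 0 ≤ N)
    (hN : ∀ x ∈ K, ∫ y, J x y ≤ N) {t : ℝ} (ht : 0 < t) :
    HasDerivAt (fun s => ∫ x in K, |softThreshold ε (u s x)| ^ p)
      (p * ∫ x in K, signedPow p (softThreshold ε (u t x)) * ∫ y, J x y * (u t y - u t x)) t := by
  obtain ⟨M, hM⟩ := hJ.bounded
  have hM0 : 0 ≤ M := (hJ.nonneg 0 0).trans (hM 0 0)
  obtain ⟨B, hB0, hB⟩ := hu.exists_ae_bound (t + 1)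
  obtain ⟨L, hL0, hL⟩ := hu.exists_integral_abs_bound (t + 1)
  have : Fact (volume K < ∞) := ⟨hKfin.lt_top⟩
  have hΨc : Continuous fun s => |softThreshold ε s| ^ p :=
    (continuous_softThreshold ε).abs.rpow_const fun _ => Or.inr (by linarith)
  have hΨ0 : |softThreshold ε 0| ^ p = 0 := by
    simp [softThreshold, hε.le, Real.zero_rpow (by linarith : p ≠ 0)]
  have hmem : Set.Ioo 0 (t + 1) ∈ 𝓝 t := Ioo_mem_nhds ht (by linarith)
  have hmeas : ∀ s, 0 ≤ s → AEStronglyMeasurable (u s) (volume.restrict K) := fun s hs =>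
    (hu.integrable hs).aestronglyMeasurable.restrict
  have key := hasDerivAt_integral_of_dominated_loc_of_deriv_le (μ := volume.restrict K)
    (F := fun s x => |softThreshold ε (u s x)| ^ p)
    (F' := fun s x => p * signedPow p (softThreshold ε (u s x)) * ∫ y, J x y * (u s y - u s x))
    (bound := fun _ => p * B ^ (p - 1) * (M * L + N * B)) (x₀ := t) hmem ?_ ?_ ?_ ?_ ?_ ?_
  · refine key.2.congr_deriv ?_
    rw [← integral_const_mul]
    simp only [mul_assoc]
  · filter_upwards [hmem] with s hs
    exact hΨc.comp_aestronglyMeasurable (hmeas s hs.1.le)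
  · exact (hu.integrable_comp hB hΨc hΨ0 hB0
      (fun a b ha hb => abs_softThreshold_rpow_sub_le hp hε ha hb)
      (t := t) ⟨ht.le, by linarith⟩).integrableOn
  · refine (((continuous_signedPow hp).comp (continuous_softThreshold ε)).comp_aestronglyMeasurable
      (hmeas t ht.le)).const_mul p |>.mul ?_
    simp_rw [hJ.integral_mul_sub (hu.integrable ht.le)]
    refine AEStronglyMeasurable.sub ?_
      (hJ.measurable_integral.aestronglyMeasurable.mul (hmeas t ht.le))
    -- the convolution-type term is jointly measurable after passing to a measurable version of `u t`
    have hmk := (hu.integrable ht.le).aestronglyMeasurable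
    have hg : Measurable fun x => ∫ y, J x y * hmk.mk (u t) y :=
      (StronglyMeasurable.integral_prod_right (f := fun x y => J x y * hmk.mk (u t) y)
        (hJ.continuous.measurable.mul
          (hmk.stronglyMeasurable_mk.measurable.comp measurable_snd)).stronglyMeasurable).measurable
    refine hg.aestronglyMeasurable.congr (Eventually.of_forall fun x => ?_)
    refine integral_congr_ae ?_
    filter_upwards [hmk.ae_eq_mk] with y hy
    rw [hy]
  · filter_upwards [ae_restrict_of_ae (hu.ae_forall_bound hB), ae_restrict_mem hK] with x hx hxK s hs
    have hi := hu.integrable hs.1.le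
    rw [norm_mul, norm_mul, Real.norm_of_nonneg (by linarith : 0 ≤ p), Real.norm_eq_abs,
      abs_signedPow hp, hJ.integral_mul_sub hi]
    have h1 : |softThreshold ε (u s x)| ^ (p - 1) ≤ B ^ (p - 1) :=
      Real.rpow_le_rpow (abs_nonneg _) ((abs_softThreshold_le hε _).trans (hx s hs)) (by linarith)
    have h2 : ‖∫ y, J x y * u s y‖ ≤ M * L := by
      refine (norm_integral_le_integral_norm _).trans ?_
      calc ∫ y, ‖J x y * u s y‖ ≤ ∫ y, M * |u s y| := by
            refine integral_mono (hJ.integrable_mul hi x).norm (hi.abs.const_mul M) fun y => ?_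
            change ‖J x y * u s y‖ ≤ M * |u s y|
            rw [norm_mul, Real.norm_of_nonneg (hJ.nonneg x y), Real.norm_eq_abs]
            exact mul_le_mul_of_nonneg_right (hM x y) (abs_nonneg _)
        _ = M * ∫ y, |u s y| := integral_const_mul _ _
        _ ≤ M * L := mul_le_mul_of_nonneg_left (hL s ⟨hs.1.le, hs.2.le⟩) hM0
    have h3 : ‖(∫ y, J x y) * u s x‖ ≤ N * B := by
      rw [norm_mul, Real.norm_of_nonneg (integral_nonneg fun y => hJ.nonneg x y), Real.norm_eq_abs]
      exact mul_le_mul (hN x hxK) (hx s hs) (abs_nonneg _) hN0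
    have h4 := (norm_sub_le (∫ y, J x y * u s y) ((∫ y, J x y) * u s x)).trans (add_le_add h2 h3)
    exact mul_le_mul (mul_le_mul_of_nonneg_left h1 (by linarith)) h4 (norm_nonneg _)
      (mul_nonneg (by linarith) (Real.rpow_nonneg hB0 _))
  · exact integrable_const _
  · filter_upwards [ae_restrict_of_ae hu.equation] with x hx s hs
    exact (hasDerivAt_abs_softThreshold_rpow hp hε (u s x)).comp s (hx s hs.1)

end IsNonlocalHeatSolution

end Evolution

/-! ### Decay inequalities between two times -/

section Decay

variable {n : ℕ} {σ c₁ : ℝ} {J : EuclideanSpace ℝ (Fin n) → EuclideanSpace ℝ (Fin n) → ℝ}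
  {u₀ : EuclideanSpace ℝ (Fin n) → ℝ} {u : ℝ → EuclideanSpace ℝ (Fin n) → ℝ}

/-- An exhaustion of `ℝⁿ` by bounded sets on which the total jump rate `∫ J x y dy`, possibly
unbounded on the whole space, is at most `N`. -/
def rateExhaustion (J : EuclideanSpace ℝ (Fin n) → EuclideanSpace ℝ (Fin n) → ℝ) (N : ℕ) :
    Set (EuclideanSpace ℝ (Fin n)) :=
  {x | ∫ y, J x y ≤ N} ∩ Metric.closedBall 0 N

lemma measurableSet_rateExhaustion (hJ : IsFatTailKernel n σ c₁ J) (N : ℕ) :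
    MeasurableSet (rateExhaustion J N) :=
  (measurableSet_le hJ.measurable_integral measurable_const).inter measurableSet_closedBall

lemma volume_rateExhaustion_ne_top (N : ℕ) : volume (rateExhaustion J N) ≠ ∞ :=
  measure_ne_top_of_subset Set.inter_subset_right measure_closedBall_lt_top.ne

lemma rateExhaustion_monotone : Monotone (rateExhaustion J) := by
  intro N N' h x hx
  have h' : (N : ℝ) ≤ N' := by exact_mod_cast h
  exact ⟨le_trans hx.1 h', Metric.closedBall_subset_closedBall h' hx.2⟩

lemma iUnion_rateExhaustion : ⋃ N, rateExhaustion J N = Set.univ := by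
  refine Set.eq_univ_of_forall fun x => ?_
  obtain ⟨N, hN⟩ := exists_nat_ge (max (∫ y, J x y) ‖x‖)
  exact Set.mem_iUnion.2 ⟨N, (le_max_left _ _).trans hN, by
    simpa using (le_max_right _ _).trans hN⟩

namespace IsNonlocalHeatSolution

/-- The mass outside `rateExhaustion J N` tends to `0` uniformly on bounded time intervals, by
Dini's theorem. -/
lemma eventually_setIntegral_compl_le (hJ : IsFatTailKernel n σ c₁ J)
    (hu : IsNonlocalHeatSolution J u₀ u) (T : ℝ) {δ : ℝ} (hδ : 0 < δ) :
    ∀ᶠ N in atTop, ∀ t ∈ Set.Icc 0 T, ∫ x in (rateExhaustion J N)ᶜ, |u t x| ≤ δ := by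
  have hlim : TendstoUniformlyOn (fun N t => ∫ x in (rateExhaustion J N)ᶜ, |u t x|)
      (fun _ => (0 : ℝ)) atTop (Set.Icc 0 T) := by
    refine Antitone.tendstoUniformlyOn_of_forall_tendsto isCompact_Icc
      (fun N => hu.continuousOn_setIntegral_abs T _) ?_ continuousOn_const ?_
    · intro t ht N N' h
      exact setIntegral_mono_set (hu.integrable ht.1).abs.integrableOn
        (Eventually.of_forall fun x => abs_nonneg _)
        (Set.compl_subset_compl.2 (rateExhaustion_monotone h)).eventuallyLE
    · intro t ht
      have h := tendsto_setIntegral_of_antitone (μ := volume) (f := fun x => |u t x|)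
        (s := fun N => (rateExhaustion J N)ᶜ)
        (fun N => (measurableSet_rateExhaustion hJ N).compl)
        (fun N N' h => Set.compl_subset_compl.2 (rateExhaustion_monotone h))
        ⟨0, (hu.integrable ht.1).abs.integrableOn⟩
      rwa [← Set.compl_iUnion, iUnion_rateExhaustion, Set.compl_univ, Measure.restrict_empty,
        integral_zero_measure] at h
  filter_upwards [Metric.tendstoUniformlyOn_iff.1 hlim δ hδ] with N hN t ht
  have := hN t ht
  rw [Real.dist_eq, zero_sub, abs_neg] at this
  exact ((le_abs_self _).trans_lt this).le

/-- The differential inequality for the truncated power on `K`, when the dissipation controls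
`a (∫ |v| ^ p - b)` for every `v` of mass at most that of `u t`. The left side is the derivative found in
`hasDerivAt_setIntegral`. -/
lemma mul_setIntegral_le (hJ : IsFatTailKernel n σ c₁ J) (hu : IsNonlocalHeatSolution J u₀ u)
    {M : ℝ} (hM : ∀ x y, J x y ≤ M) {p ε a b B L N : ℝ} (hp : 1 < p) (hε : 0 < ε) {t : ℝ}
    (ht : 0 ≤ t) (hB0 : 0 ≤ B) (hB : ∀ᵐ x, |u t x| ≤ B) (hL : ∫ x, |u t x| ≤ L)
    (hnash : ∀ v : EuclideanSpace ℝ (Fin n) → ℝ, Measurable v → Integrable v →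
      Integrable (fun x => |v x| ^ p) →
      Integrable (fun z : EuclideanSpace ℝ (Fin n) × EuclideanSpace ℝ (Fin n) =>
        J z.1 z.2 * signedPairing p (v z.1) (v z.2)) →
      ∫ x, |v x| ≤ ∫ x, |u t x| → a * ((∫ x, |v x| ^ p) - b) ≤
        ∫ z : EuclideanSpace ℝ (Fin n) × EuclideanSpace ℝ (Fin n),
          J z.1 z.2 * signedPairing p (v z.1) (v z.2))
    {K : Set (EuclideanSpace ℝ (Fin n))} (hK : MeasurableSet K) (hN0 : 0 ≤ N)
    (hN : ∀ x ∈ K, ∫ y, J x y ≤ N) :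
    p * ∫ x in K, signedPow p (softThreshold ε (u t x)) * ∫ y, J x y * (u t y - u t x) ≤
      -(p / 2 * a) * ((∫ x in K, |softThreshold ε (u t x)| ^ p) - b)
        + p * (M * (B ^ (p - 1) / ε * L)) * ∫ x in Kᶜ, |u t x| := by
  have hM0 : 0 ≤ M := (hJ.nonneg 0 0).trans (hM 0 0)
  have hui := hu.integrable ht
  have hmk := hui.aestronglyMeasurable
  set f : EuclideanSpace ℝ (Fin n) → ℝ := hmk.mk (u t) with hf
  have hfm : Measurable f := hmk.stronglyMeasurable_mk.measurable
  have hfu : f =ᵐ[volume] u t := hmk.ae_eq_mk.symm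
  have hfi : Integrable f := hui.congr hfu.symm
  have hfB : ∀ᵐ x, |f x| ≤ B := by filter_upwards [hB, hfu] with x hx hx'; rwa [hx']
  obtain ⟨hGi, hle⟩ := setIntegral_signedPow_mul_le hJ hM hp hε hfm hfi hB0 hfB hK hN0 hN rfl
  set v : EuclideanSpace ℝ (Fin n) → ℝ := K.indicator fun x => softThreshold ε (f x) with hv
  have hvm : Measurable v := ((continuous_softThreshold ε).measurable.comp hfm).indicator hK
  have hvf : ∀ x, |v x| ≤ |f x| := fun x => by
    by_cases hx : x ∈ K
    · rw [hv, Set.indicator_of_mem hx]; exact abs_softThreshold_le hε _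
    · rw [hv, Set.indicator_of_notMem hx, abs_zero]; exact abs_nonneg _
  have hvi : Integrable v := hfi.abs.mono' hvm.aestronglyMeasurable (Eventually.of_forall hvf)
  have hvp : (fun x => |v x| ^ p) = K.indicator fun x => |softThreshold ε (f x)| ^ p := by
    ext x
    by_cases hx : x ∈ K
    · simp [hv, hx]
    · simp [hv, hx, Real.zero_rpow (by linarith : p ≠ 0)]
  have hvpi : Integrable fun x => |v x| ^ p := by
    refine (hfi.abs.const_mul (B ^ (p - 1))).mono'
      (hvm.abs.pow_const p).aestronglyMeasurable ?_
    filter_upwards [hfB] with x hx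
    rw [Real.norm_of_nonneg (by positivity)]
    calc |v x| ^ p ≤ |f x| ^ p := Real.rpow_le_rpow (abs_nonneg _) (hvf x) (by linarith)
      _ ≤ B ^ (p - 1) * |f x| := abs_rpow_le_mul_abs hp.le hx
  have habs : ∫ x, |f x| = ∫ x, |u t x| :=
    integral_congr_ae (by filter_upwards [hfu] with x hx; rw [hx])
  have hn := hnash v hvm hvi hvpi hGi
    (habs ▸ integral_mono hvi.abs hfi.abs hvf)
  have e1 : ∫ x, |v x| ^ p = ∫ x in K, |softThreshold ε (u t x)| ^ p := by
    rw [hvp, integral_indicator hK]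
    exact integral_congr_ae (ae_restrict_of_ae (by filter_upwards [hfu] with x hx; rw [hx]))
  have e2 : ∫ x in K, signedPow p (softThreshold ε (f x)) * ∫ y, J x y * (f y - f x) =
      ∫ x in K, signedPow p (softThreshold ε (u t x)) * ∫ y, J x y * (u t y - u t x) := by
    refine integral_congr_ae (ae_restrict_of_ae ?_)
    filter_upwards [hfu] with x hx
    rw [hx]
    congr 1
    exact integral_congr_ae (by filter_upwards [hfu] with y hy; rw [hy])
  have e3 : ∫ x in Kᶜ, |f x| = ∫ x in Kᶜ, |u t x| :=
    integral_congr_ae (ae_restrict_of_ae (by filter_upwards [hfu] with x hx; rw [hx]))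
  rw [e1] at hn
  rw [e2, e3, habs] at hle
  have h0 : 0 ≤ ∫ x in Kᶜ, |u t x| := integral_nonneg fun x => abs_nonneg _
  have h1 : M * (B ^ (p - 1) / ε * ∫ x, |u t x|) * ∫ x in Kᶜ, |u t x| ≤
      M * (B ^ (p - 1) / ε * L) * ∫ x in Kᶜ, |u t x| := by gcongr
  have h2 := mul_le_mul_of_nonneg_left (hle.trans (add_le_add_right h1 _))
    (by linarith : 0 ≤ p)
  have h3 := mul_le_mul_of_nonneg_left hn (by linarith : 0 ≤ p / 2)
  linarith

/-- Integration in time of the previous differential inequality, after which the exhaustion of `ℝⁿ` is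
let go to infinity and the error term disappears. -/
lemma integral_abs_softThreshold_rpow_le (hJ : IsFatTailKernel n σ c₁ J)
    (hu : IsNonlocalHeatSolution J u₀ u) {p ε a b : ℝ} (hp : 1 < p) (hε : 0 < ε) (ha : 0 ≤ a)
    (hb : 0 ≤ b)
    (hnash : ∀ t, 0 < t → ∀ v : EuclideanSpace ℝ (Fin n) → ℝ, Measurable v → Integrable v →
      Integrable (fun x => |v x| ^ p) →
      Integrable (fun z : EuclideanSpace ℝ (Fin n) × EuclideanSpace ℝ (Fin n) =>
        J z.1 z.2 * signedPairing p (v z.1) (v z.2)) →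
      ∫ x, |v x| ≤ ∫ x, |u t x| → a * ((∫ x, |v x| ^ p) - b) ≤
        ∫ z : EuclideanSpace ℝ (Fin n) × EuclideanSpace ℝ (Fin n),
          J z.1 z.2 * signedPairing p (v z.1) (v z.2))
    {s t : ℝ} (hs : 0 ≤ s) (hst : s ≤ t) :
    ∫ x, |softThreshold ε (u t x)| ^ p ≤
      Real.exp (-(p / 2 * a) * (t - s)) * (∫ x, |softThreshold ε (u s x)| ^ p) + b := by
  obtain ⟨M, hM⟩ := hJ.bounded
  have hM0 : 0 ≤ M := (hJ.nonneg 0 0).trans (hM 0 0)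
  obtain ⟨B, hB0, hB⟩ := hu.exists_ae_bound t
  obtain ⟨L, hL0, hL⟩ := hu.exists_integral_abs_bound t
  have hΨc : Continuous fun s => |softThreshold ε s| ^ p :=
    (continuous_softThreshold ε).abs.rpow_const fun _ => Or.inr (by linarith)
  have hΨ0 : |softThreshold ε 0| ^ p = 0 := by
    simp [softThreshold, hε.le, Real.zero_rpow (by linarith : p ≠ 0)]
  have hΨ := fun a b (ha : |a| ≤ B) (hb : |b| ≤ B) => abs_softThreshold_rpow_sub_le hp hε ha hb
  have hlim : ∀ τ ∈ Set.Icc 0 t, Tendsto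
      (fun N => ∫ x in rateExhaustion J N, |softThreshold ε (u τ x)| ^ p) atTop
      (𝓝 (∫ x, |softThreshold ε (u τ x)| ^ p)) := by
    intro τ hτ
    have h := tendsto_setIntegral_of_monotone (μ := volume)
      (f := fun x => |softThreshold ε (u τ x)| ^ p)
      (fun N => measurableSet_rateExhaustion hJ N) rateExhaustion_monotone
      (hu.integrable_comp hB hΨc hΨ0 hB0 hΨ hτ).integrableOn
    rwa [iUnion_rateExhaustion, Measure.restrict_univ] at h
  have ht : t ∈ Set.Icc 0 t := ⟨hs.trans hst, le_rfl⟩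
  set C : ℝ := p * (M * (B ^ (p - 1) / ε * L)) with hC
  have hC0 : 0 ≤ C := by positivity
  have hstep : ∀ δ : ℝ, 0 < δ → ∫ x, |softThreshold ε (u t x)| ^ p ≤
      Real.exp (-(p / 2 * a) * (t - s)) * (∫ x, |softThreshold ε (u s x)| ^ p) + b
        + C * δ * (t - s) := by
    intro δ hδ
    refine le_of_tendsto_of_tendsto (hlim t ht)
      ((((hlim s ⟨hs, hst⟩).const_mul _).add_const b).add_const _) ?_
    filter_upwards [hu.eventually_setIntegral_compl_le hJ t hδ] with N hN
    have hNr : ∀ x ∈ rateExhaustion J N, ∫ y, J x y ≤ N := fun x hx => hx.1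
    refine le_exp_mul_add_of_hasDerivAt_le (by positivity) hb (by positivity) hst
      ((hu.continuousOn_setIntegral_comp hB hΨc hΨ0 hB0 hΨ _).mono
        (Set.Icc_subset_Icc_left hs))
      (fun τ hτ => hu.hasDerivAt_setIntegral hJ hp hε (measurableSet_rateExhaustion hJ N)
        (volume_rateExhaustion_ne_top N) (Nat.cast_nonneg N) hNr (hs.trans_lt hτ.1)) ?_
    intro τ hτ
    have hτ0 : 0 < τ := hs.trans_lt hτ.1
    have hτI : τ ∈ Set.Icc 0 t := ⟨hτ0.le, hτ.2.le⟩
    refine (hu.mul_setIntegral_le hJ hM hp hε hτ0.le hB0 (hB τ hτI.1 hτI.2) (hL τ hτI)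
      (hnash τ hτ0) (measurableSet_rateExhaustion hJ N) (Nat.cast_nonneg N) hNr).trans ?_
    exact add_le_add_right (mul_le_mul_of_nonneg_left (hN τ hτI) hC0) _
  refine le_of_forall_pos_le_add fun η hη => ?_
  have hD : 0 ≤ C * (t - s) := mul_nonneg hC0 (by linarith)
  refine (hstep (η / (C * (t - s) + 1)) (by positivity)).trans ?_
  have : C * (η / (C * (t - s) + 1)) * (t - s) ≤ η := by
    rw [show C * (η / (C * (t - s) + 1)) * (t - s) = η * ((C * (t - s)) / (C * (t - s) + 1)) by ring]
    exact mul_le_of_le_one_right hη.le ((div_le_one (by positivity)).2 (by linarith))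
  linarith

lemma memLp_ofReal (hu : IsNonlocalHeatSolution J u₀ u) {t : ℝ} (ht : 0 ≤ t) {p : ℝ}
    (hp : 1 ≤ p) : MemLp (u t) (ENNReal.ofReal p) volume := by
  obtain ⟨B, hB0, hB⟩ := hu.exists_ae_bound t
  have hui := hu.integrable ht
  rw [← integrable_norm_rpow_iff hui.aestronglyMeasurable
    (by simpa using (by linarith : 0 < p)) ENNReal.ofReal_ne_top,
    ENNReal.toReal_ofReal (by linarith)]
  refine (hui.abs.const_mul (B ^ (p - 1))).mono' (hui.aestronglyMeasurable.norm.aemeasurable.pow_const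
    p).aestronglyMeasurable ?_
  filter_upwards [hB t ht le_rfl] with x hx
  rw [Real.norm_of_nonneg (by positivity)]
  exact abs_rpow_le_mul_abs hp hx

/-- Removal of the truncation, along exponents that may vary with the truncation level. -/
lemma tendsto_integral_abs_softThreshold_rpow (hu : IsNonlocalHeatSolution J u₀ u) {t : ℝ}
    (ht : 0 ≤ t) {p : ℝ} (hp : 1 ≤ p) {r ε : ℕ → ℝ} (hr : Tendsto r atTop (𝓝 p))
    (hr1 : ∀ k, 1 ≤ r k) (hε : Tendsto ε atTop (𝓝 0)) (hε0 : ∀ k, 0 < ε k) :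
    Tendsto (fun k => ∫ x, |softThreshold (ε k) (u t x)| ^ r k) atTop (𝓝 (∫ x, |u t x| ^ p)) := by
  obtain ⟨B, hB0, hB⟩ := hu.exists_ae_bound t
  obtain ⟨Q, hQ⟩ := hr.bddAbove_range
  have hui := hu.integrable ht
  refine tendsto_integral_of_dominated_convergence (fun x => (B + 1) ^ (Q - 1) * |u t x|) ?_
    (hui.abs.const_mul _) ?_ ?_
  · intro k
    exact ((continuous_softThreshold (ε k)).abs.rpow_const fun _ => Or.inr
      (by linarith [hr1 k])).comp_aestronglyMeasurable hui.aestronglyMeasurable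
  · intro k
    filter_upwards [hB t ht le_rfl] with x hx
    have hk := hr1 k
    have hkQ : r k ≤ Q := hQ (Set.mem_range_self k)
    rw [Real.norm_of_nonneg (by positivity)]
    calc |softThreshold (ε k) (u t x)| ^ r k ≤ |u t x| ^ r k :=
          Real.rpow_le_rpow (abs_nonneg _) (abs_softThreshold_le (hε0 k) _) (by linarith)
      _ ≤ (B + 1) ^ (r k - 1) * |u t x| := abs_rpow_le_mul_abs hk (by linarith)
      _ ≤ (B + 1) ^ (Q - 1) * |u t x| := by gcongr; linarith
  · refine Eventually.of_forall fun x => ?_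
    exact (((tendsto_softThreshold (u t x)).comp hε).abs).rpow hr (Or.inr (by linarith))

/-- Contraction in `L¹`, as the limit `p → 1` of the monotonicity of the truncated powers. -/
lemma integral_abs_le (hJ : IsFatTailKernel n σ c₁ J) (hu : IsNonlocalHeatSolution J u₀ u)
    {t : ℝ} (ht : 0 ≤ t) : ∫ x, |u t x| ≤ ∫ x, |u 0 x| := by
  have hε : Tendsto (fun k : ℕ => 1 / ((k : ℝ) + 1)) atTop (𝓝 0) :=
    tendsto_one_div_add_atTop_nhds_zero_nat
  have hr : Tendsto (fun k : ℕ => 1 + 1 / ((k : ℝ) + 1)) atTop (𝓝 1) := by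
    simpa using hε.const_add 1
  have hε0 : ∀ k : ℕ, 0 < 1 / ((k : ℝ) + 1) := fun k => by positivity
  have hlim := fun {t : ℝ} (ht : 0 ≤ t) => hu.tendsto_integral_abs_softThreshold_rpow ht le_rfl hr
    (fun k => by linarith [hε0 k]) hε hε0
  simp only [Real.rpow_one] at hlim
  refine le_of_tendsto_of_tendsto' (hlim ht) (hlim le_rfl) fun k => ?_
  have h := hu.integral_abs_softThreshold_rpow_le hJ (p := 1 + 1 / ((k : ℝ) + 1)) (a := 0) (b := 0)
    (by linarith [hε0 k]) (hε0 k) le_rfl le_rfl (fun t _ v _ _ _ _ _ => by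
      rw [zero_mul]
      exact integral_nonneg fun z =>
        mul_nonneg (hJ.nonneg _ _) (signedPairing_nonneg (by linarith [hε0 k]) _ _)) le_rfl ht
  simpa using h

/-- Decay of `∫ |u|ᵖ` between two times, with the scale `R ≥ 1` at our disposal. -/
lemma exists_integral_rpow_le (hn : 1 ≤ n) (hc₁ : 0 < c₁) (hσ : 0 < σ) {p : ℝ} (hp : 1 < p) :
    ∃ κ A : ℝ, 0 < κ ∧ 0 < A ∧
      ∀ J : EuclideanSpace ℝ (Fin n) → EuclideanSpace ℝ (Fin n) → ℝ, IsFatTailKernel n σ c₁ J →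
      ∀ (u₀ : EuclideanSpace ℝ (Fin n) → ℝ) (u : ℝ → EuclideanSpace ℝ (Fin n) → ℝ),
      IsNonlocalHeatSolution J u₀ u → ∀ R s t : ℝ, 1 ≤ R → 0 ≤ s → s ≤ t →
        ∫ x, |u t x| ^ p ≤ Real.exp (-(κ * R ^ (-(2 * σ)) * (t - s))) * (∫ x, |u s x| ^ p)
          + A * R ^ (-((n : ℝ) * (p - 1))) * (∫ x, |u 0 x|) ^ p := by
  obtain ⟨κ, A, hκ, hA, hnash⟩ := nash_inequality hn hc₁ hσ hp
  refine ⟨p / 2 * κ, A, by positivity, hA, fun J hJ u₀ u hu R s t hR hs hst => ?_⟩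
  have hR0 : 0 < R := by linarith
  have hm : 0 ≤ ∫ x, |u 0 x| := integral_nonneg fun x => abs_nonneg _
  have hε : Tendsto (fun k : ℕ => 1 / ((k : ℝ) + 1)) atTop (𝓝 0) :=
    tendsto_one_div_add_atTop_nhds_zero_nat
  have hε0 : ∀ k : ℕ, 0 < 1 / ((k : ℝ) + 1) := fun k => by positivity
  have hlim := fun {t : ℝ} (ht : 0 ≤ t) => hu.tendsto_integral_abs_softThreshold_rpow ht hp.le
    (r := fun _ => p) tendsto_const_nhds (fun _ => hp.le) hε hε0
  refine le_of_tendsto_of_tendsto' (hlim (hs.trans hst)) (((hlim hs).const_mul _).add_const _)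
    fun k => ?_
  have h := hu.integral_abs_softThreshold_rpow_le hJ (a := κ * R ^ (-(2 * σ)))
    (b := A * R ^ (-((n : ℝ) * (p - 1))) * (∫ x, |u 0 x|) ^ p) hp (hε0 k) (by positivity)
    (by positivity) (fun t ht v hv hvi hvp hG hvm =>
      hnash J hJ v hv hvi hvp hG _ R (hvm.trans (hu.integral_abs_le hJ ht.le)) hR) hs hst
  rwa [show -(p / 2 * κ * R ^ (-(2 * σ)) * (t - s)) = -(p / 2 * (κ * R ^ (-(2 * σ)))) * (t - s) by
    ring]

end IsNonlocalHeatSolution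

end Decay

/-! ### Iteration over dyadic times -/

section HalvingRecursion

variable {Z : ℝ → ℝ} {t₀ b W : ℝ}

/-- The bound `W` on an initial interval propagates to all times, at the cost of `2 b`. -/
lemma le_of_halving_recursion (ht₀ : 0 < t₀) (hb : 0 ≤ b) (hW0 : 0 ≤ W)
    (hrec : ∀ t, t₀ ≤ t → Z t ≤ 1 / 2 * Z (t / 2) + b) (hW : ∀ t, 0 < t → t ≤ t₀ → Z t ≤ W)
    {t : ℝ} (ht : 0 < t) : Z t ≤ W + 2 * b := by
  have key : ∀ k : ℕ, ∀ t, 0 < t → t ≤ 2 ^ k * t₀ → Z t ≤ W + 2 * b := by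
    intro k
    induction k with
    | zero =>
      intro t ht htk
      linarith [hW t ht (by simpa using htk)]
    | succ k ih =>
      intro t ht htk
      rcases le_total t t₀ with h | h
      · linarith [hW t ht h]
      · linarith [hrec t h, ih (t / 2) (by linarith) (by rw [pow_succ] at htk; linarith)]
  obtain ⟨k, hk⟩ := pow_unbounded_of_one_lt (t / t₀) (one_lt_two : (1 : ℝ) < 2)
  exact key k t ht ((div_le_iff₀ ht₀).1 hk.le)

/-- The influence of the initial bound `W` is halved with every doubling of the time. -/
lemma le_add_of_halving_recursion (hrec : ∀ t, t₀ ≤ t → Z t ≤ 1 / 2 * Z (t / 2) + b)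
    (ht₀ : 0 < t₀) (hW : ∀ t, 0 < t → Z t ≤ W + 2 * b) (k : ℕ) {t : ℝ} (ht : 2 ^ k * t₀ ≤ t) :
    Z t ≤ 2 * b + W / 2 ^ k := by
  induction k generalizing t with
  | zero =>
    have := hW t (by linarith)
    simpa [add_comm] using this
  | succ k ih =>
    have hk : (1 : ℝ) ≤ 2 ^ k := one_le_pow₀ (by norm_num)
    have h0 : t₀ ≤ 2 ^ k * t₀ := le_mul_of_one_le_left ht₀.le hk
    rw [pow_succ] at ht
    have h1 := hrec t (by linarith)
    have h2 := ih (t := t / 2) (by linarith)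
    rw [pow_succ, ← div_div]
    linarith

end HalvingRecursion

section PowerDecay

variable {n : ℕ} {σ c₁ : ℝ}

/-- Choosing the diffusive scale `R = (δ t) ^ (1 / (2σ))` and `s = t / 2` turns the decay inequality
into the recursion `Z t ≤ Z (t / 2) / 2 + D m ^ q` for `Z t = t ^ α ∫ |u t| ^ q`, where `m` is the
initial mass and `α = n (q - 1) / (2σ)`. -/
lemma exists_halving_recursion (hn : 1 ≤ n) (hc₁ : 0 < c₁) (hσ : 0 < σ) {q : ℝ} (hq : 1 < q) :
    ∃ t₀ A D : ℝ, 0 < t₀ ∧ 0 < A ∧ 0 < D ∧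
      ∀ J : EuclideanSpace ℝ (Fin n) → EuclideanSpace ℝ (Fin n) → ℝ, IsFatTailKernel n σ c₁ J →
      ∀ (u₀ : EuclideanSpace ℝ (Fin n) → ℝ) (u : ℝ → EuclideanSpace ℝ (Fin n) → ℝ),
      IsNonlocalHeatSolution J u₀ u →
        (∀ t, 0 ≤ t → ∫ x, |u t x| ^ q ≤ (∫ x, |u 0 x| ^ q) + A * (∫ x, |u 0 x|) ^ q) ∧
        ∀ t, t₀ ≤ t → t ^ ((n : ℝ) * (q - 1) / (2 * σ)) * ∫ x, |u t x| ^ q ≤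
          1 / 2 * ((t / 2) ^ ((n : ℝ) * (q - 1) / (2 * σ)) * ∫ x, |u (t / 2) x| ^ q)
            + D * (∫ x, |u 0 x|) ^ q := by
  obtain ⟨κ, A, hκ, hA, hdecay⟩ :=
    IsNonlocalHeatSolution.exists_integral_rpow_le (n := n) (σ := σ) hn hc₁ hσ hq
  set α : ℝ := (n : ℝ) * (q - 1) / (2 * σ) with hα
  -- `δ` is chosen so small that the exponential factor beats the factor `2 ^ α` lost by halving
  obtain ⟨δ, hδ, hexp⟩ : ∃ δ : ℝ, 0 < δ ∧ Real.exp (-(κ / (2 * δ))) ≤ 1 / 2 * (1 / 2) ^ α := by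
    obtain ⟨x, hx, hx0⟩ := ((Real.tendsto_exp_neg_atTop_nhds_zero.eventually
      (gt_mem_nhds (show (0 : ℝ) < 1 / 2 * (1 / 2) ^ α by positivity))).and
      (eventually_gt_atTop 0)).exists
    refine ⟨κ / (2 * x), by positivity, ?_⟩
    rw [show κ / (2 * (κ / (2 * x))) = x by field_simp]
    exact hx.le
  refine ⟨1 / δ, A, A * δ ^ (-α), by positivity, hA, by positivity, fun J hJ u₀ u hu => ⟨?_, ?_⟩⟩
  · intro t ht
    have h := hdecay J hJ u₀ u hu 1 0 t le_rfl le_rfl ht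
    rw [Real.one_rpow, Real.one_rpow, mul_one, mul_one, sub_zero] at h
    have hY : 0 ≤ ∫ x, |u 0 x| ^ q := integral_nonneg fun x => by positivity
    have : Real.exp (-(κ * t)) ≤ 1 := Real.exp_le_one_iff.2 (by nlinarith)
    linarith [mul_le_of_le_one_left hY this]
  · intro t ht
    have ht0 : 0 < t := lt_of_lt_of_le (by positivity) ht
    have hδt : 1 ≤ δ * t := by
      rw [div_le_iff₀ hδ] at ht; linarith
    set R : ℝ := (δ * t) ^ (1 / (2 * σ)) with hR
    have hR1 : 1 ≤ R := Real.one_le_rpow hδt (by positivity)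
    have h := hdecay J hJ u₀ u hu R (t / 2) t hR1 (by linarith) (by linarith)
    have e1 : κ * R ^ (-(2 * σ)) * (t - t / 2) = κ / (2 * δ) := by
      rw [hR, ← Real.rpow_mul (by positivity),
        show 1 / (2 * σ) * -(2 * σ) = -1 by field_simp, Real.rpow_neg_one]
      field_simp
      ring
    have e2 : R ^ (-((n : ℝ) * (q - 1))) = δ ^ (-α) * t ^ (-α) := by
      rw [hR, ← Real.rpow_mul (by positivity), ← Real.mul_rpow hδ.le ht0.le]
      congr 1
      rw [hα]; field_simp
    rw [e1, e2] at h
    have hY : 0 ≤ ∫ x, |u (t / 2) x| ^ q := integral_nonneg fun x => by positivity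
    have htt : t ^ α * t ^ (-α) = 1 := by
      rw [← Real.rpow_add ht0, add_neg_cancel, Real.rpow_zero]
    have hhalf : (t / 2) ^ α = (1 / 2) ^ α * t ^ α := by
      rw [← Real.mul_rpow (by norm_num) ht0.le]; ring_nf
    calc t ^ α * ∫ x, |u t x| ^ q
        ≤ t ^ α * (1 / 2 * (1 / 2) ^ α * (∫ x, |u (t / 2) x| ^ q)
          + A * (δ ^ (-α) * t ^ (-α)) * (∫ x, |u 0 x|) ^ q) := by
          refine mul_le_mul_of_nonneg_left (h.trans ?_) (by positivity)
          gcongr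
      _ = 1 / 2 * ((1 / 2) ^ α * t ^ α * ∫ x, |u (t / 2) x| ^ q)
            + A * δ ^ (-α) * (t ^ α * t ^ (-α)) * (∫ x, |u 0 x|) ^ q := by ring
      _ = _ := by rw [htt, hhalf, mul_one]

/-- The real-variable form of the decay statement: a bound at all times and an asymptotic bound
which sees only the initial mass. -/
lemma exists_power_decay (hn : 1 ≤ n) (hc₁ : 0 < c₁) (hσ : 0 < σ) {q : ℝ} (hq : 1 < q) :
    ∃ D : ℝ, 0 < D ∧
      ∀ J : EuclideanSpace ℝ (Fin n) → EuclideanSpace ℝ (Fin n) → ℝ, IsFatTailKernel n σ c₁ J →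
      ∀ (u₀ : EuclideanSpace ℝ (Fin n) → ℝ) (u : ℝ → EuclideanSpace ℝ (Fin n) → ℝ),
      IsNonlocalHeatSolution J u₀ u →
        (∀ t, 0 < t → t ^ ((n : ℝ) * (q - 1) / (2 * σ)) * ∫ x, |u t x| ^ q ≤
          D * max ((∫ x, |u 0 x|) ^ q) (∫ x, |u 0 x| ^ q)) ∧
        ∀ η : ℝ, 0 < η → ∀ᶠ t in atTop, t ^ ((n : ℝ) * (q - 1) / (2 * σ)) * ∫ x, |u t x| ^ q ≤
          D * (∫ x, |u 0 x|) ^ q + η := by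
  obtain ⟨t₀, A, D, ht₀, hA, hD, hrec⟩ := exists_halving_recursion (n := n) hn hc₁ hσ hq
  set α : ℝ := (n : ℝ) * (q - 1) / (2 * σ) with hα
  have hα0 : 0 ≤ α := by
    have : 0 ≤ q - 1 := by linarith
    positivity
  refine ⟨t₀ ^ α * (1 + A) + 2 * D, by positivity, fun J hJ u₀ u hu => ?_⟩
  obtain ⟨h0, hrec⟩ := hrec J hJ u₀ u hu
  set m : ℝ := ∫ x, |u 0 x| with hm
  set Y : ℝ := ∫ x, |u 0 x| ^ q with hY
  have hm0 : 0 ≤ m := integral_nonneg fun x => abs_nonneg _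
  have hY0 : 0 ≤ Y := integral_nonneg fun x => by positivity
  set W : ℝ := t₀ ^ α * (Y + A * m ^ q) with hW
  have hW0 : 0 ≤ W := by positivity
  have hb : 0 ≤ D * m ^ q := by positivity
  have hinit : ∀ t, 0 < t → t ≤ t₀ → t ^ α * ∫ x, |u t x| ^ q ≤ W := fun t ht htt =>
    mul_le_mul (Real.rpow_le_rpow ht.le htt hα0) (h0 t ht.le)
      (integral_nonneg fun x => by positivity) (by positivity)
  have hbd : ∀ t, 0 < t → t ^ α * ∫ x, |u t x| ^ q ≤ W + 2 * (D * m ^ q) := fun t ht =>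
    le_of_halving_recursion (Z := fun t => t ^ α * ∫ x, |u t x| ^ q) ht₀ hb hW0 hrec hinit ht
  constructor
  · intro t ht
    refine (hbd t ht).trans ?_
    have h1 : m ^ q ≤ max (m ^ q) Y := le_max_left _ _
    have h2 : Y ≤ max (m ^ q) Y := le_max_right _ _
    calc W + 2 * (D * m ^ q) ≤ t₀ ^ α * (max (m ^ q) Y + A * max (m ^ q) Y)
          + 2 * (D * max (m ^ q) Y) := by rw [hW]; gcongr
      _ = _ := by ring
  · intro η hη
    obtain ⟨k, hk⟩ := pow_unbounded_of_one_lt (W / η) (one_lt_two : (1 : ℝ) < 2)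
    filter_upwards [eventually_ge_atTop (2 ^ k * t₀)] with t ht
    have h1 := le_add_of_halving_recursion (Z := fun t => t ^ α * ∫ x, |u t x| ^ q) hrec ht₀ hbd k ht
    have h2 : W / 2 ^ k ≤ η := by
      rw [div_le_iff₀ (by positivity)]
      rw [div_lt_iff₀ hη] at hk
      linarith
    have h3 : 0 ≤ t₀ ^ α * (1 + A) * m ^ q := by positivity
    linarith

end PowerDecay

theorem theorem1 (n : ℕ) (hn : 2 ≤ n) (σ : ℝ) (hσ₀ : 0 < σ) (hσ₁ : σ < 1)
    (c₁ : ℝ) (hc₁ : 0 < c₁) (q : ℝ) (hq₁ : 1 < q) (hqσ : 2 * σ < q) :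
    ∃ C : ℝ, 0 < C ∧
      ∀ J : EuclideanSpace ℝ (Fin n) → EuclideanSpace ℝ (Fin n) → ℝ,
        IsFatTailKernel n σ c₁ J →
      ∀ u₀ : EuclideanSpace ℝ (Fin n) → ℝ, MemLp u₀ 1 volume → MemLp u₀ ∞ volume →
      ∀ u : ℝ → EuclideanSpace ℝ (Fin n) → ℝ, IsNonlocalHeatSolution J u₀ u →
        Tendsto (fun t : ℝ => eLpNorm (u t) (ENNReal.ofReal q) volume) atTop (𝓝 0) ∧
        limsup (fun t : ℝ => ENNReal.ofReal (t ^ ((n : ℝ) / (2 * σ) * (1 - 1 / q))) *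
            eLpNorm (u t) (ENNReal.ofReal q) volume) atTop
          ≤ ENNReal.ofReal C * eLpNorm u₀ 1 volume ∧
        ∀ t : ℝ, 0 < t →
          eLpNorm (u t) (ENNReal.ofReal q) volume
            ≤ ENNReal.ofReal C *
                max (eLpNorm u₀ 1 volume) (eLpNorm u₀ (ENNReal.ofReal q) volume) *
                ENNReal.ofReal (t ^ (-((n : ℝ) / (2 * σ) * (1 - 1 / q)))) := by
  obtain ⟨D, hD, hdecay⟩ := exists_power_decay (n := n) (σ := σ) (by omega) hc₁ hσ₀ hq₁
  have hq0 : 0 < q := by linarith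
  refine ⟨D ^ (1 / q), by positivity, fun J hJ u₀ _ _ u hu => ?_⟩
  obtain ⟨hall, hasymp⟩ := hdecay J hJ u₀ u hu
  set γ : ℝ := (n : ℝ) / (2 * σ) * (1 - 1 / q) with hγ
  have hγ0 : 0 < γ := by
    have h1 : 1 / q < 1 := (div_lt_one hq0).2 hq₁
    have h2 : (0 : ℝ) < n := by exact_mod_cast (by omega : 0 < n)
    have h3 : 0 < 1 - 1 / q := by linarith
    positivity
  have hαγ : (n : ℝ) * (q - 1) / (2 * σ) = γ * q := by rw [hγ]; field_simp
  rw [hαγ] at hall hasymp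
  set m : ℝ := ∫ x, |u 0 x| with hm
  set Y : ℝ → ℝ := fun t => ∫ x, |u t x| ^ q with hY
  have hm0 : 0 ≤ m := integral_nonneg fun x => abs_nonneg _
  have hY0 : ∀ t, 0 ≤ Y t := fun t => integral_nonneg fun x => by positivity
  have hnorm : ∀ t, 0 ≤ t → eLpNorm (u t) (ENNReal.ofReal q) volume
      = ENNReal.ofReal (Y t ^ (1 / q)) := by
    intro t ht
    have hmem : MemLp (u t) (ENNReal.ofReal q) volume := hu.memLp_ofReal ht hq₁.le
    rw [hmem.eLpNorm_eq_integral_rpow_norm (by simpa using hq0) ENNReal.ofReal_ne_top,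
      ENNReal.toReal_ofReal hq0.le, one_div]
    rfl
  have hnorm1 : eLpNorm u₀ 1 volume = ENNReal.ofReal m := by
    rw [← eLpNorm_congr_ae hu.initial, eLpNorm_one_eq_lintegral_enorm,
      ← ofReal_integral_norm_eq_lintegral_enorm (hu.integrable le_rfl)]
    rfl
  have hnormq : eLpNorm u₀ (ENNReal.ofReal q) volume = ENNReal.ofReal (Y 0 ^ (1 / q)) := by
    rw [← eLpNorm_congr_ae hu.initial, hnorm 0 le_rfl]
  have hmul : ∀ t, 0 < t → t ^ γ * Y t ^ (1 / q) = (t ^ (γ * q) * Y t) ^ (1 / q) := by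
    intro t ht
    rw [Real.mul_rpow (by positivity) (hY0 t), ← Real.rpow_mul ht.le]
    congr 2; field_simp
  have hbound : ∀ t : ℝ, 0 < t → eLpNorm (u t) (ENNReal.ofReal q) volume
      ≤ ENNReal.ofReal (D ^ (1 / q)) *
          max (eLpNorm u₀ 1 volume) (eLpNorm u₀ (ENNReal.ofReal q) volume) *
          ENNReal.ofReal (t ^ (-γ)) := by
    intro t ht
    rw [hnorm t ht.le, hnorm1, hnormq, ← ENNReal.ofReal_max, ← ENNReal.ofReal_mul (by positivity),
      ← ENNReal.ofReal_mul (by positivity)]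
    refine ENNReal.ofReal_le_ofReal ?_
    have h1 : t ^ γ * Y t ^ (1 / q) ≤ D ^ (1 / q) * max m (Y 0 ^ (1 / q)) := by
      rw [hmul t ht]
      have h2 : m = (m ^ q) ^ (1 / q) := by
        rw [← Real.rpow_mul hm0, mul_one_div_cancel hq0.ne', Real.rpow_one]
      have h3 : max m (Y 0 ^ (1 / q)) = max (m ^ q) (Y 0) ^ (1 / q) := by
        rcases le_total (m ^ q) (Y 0) with h | h
        · rw [max_eq_right h, max_eq_right]
          rw [h2]; exact Real.rpow_le_rpow (by positivity) h (by positivity)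
        · rw [max_eq_left h, ← h2, max_eq_left]
          rw [h2]; exact Real.rpow_le_rpow (hY0 0) h (by positivity)
      rw [h3, ← Real.mul_rpow hD.le (le_max_of_le_right (hY0 0))]
      exact Real.rpow_le_rpow (mul_nonneg (by positivity) (hY0 t)) (hall t ht) (by positivity)
    rw [Real.rpow_neg ht.le, ← div_eq_mul_inv, le_div_iff₀ (by positivity)]
    linarith
  refine ⟨?_, ?_, hbound⟩
  · have hz : Tendsto (fun t : ℝ => ENNReal.ofReal (D ^ (1 / q)) *
          max (eLpNorm u₀ 1 volume) (eLpNorm u₀ (ENNReal.ofReal q) volume) *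
          ENNReal.ofReal (t ^ (-γ))) atTop (𝓝 0) := by
      have h1 : Tendsto (fun t : ℝ => ENNReal.ofReal (t ^ (-γ))) atTop (𝓝 0) := by
        simpa using ENNReal.tendsto_ofReal (tendsto_rpow_neg_atTop hγ0)
      have h2 := ENNReal.Tendsto.const_mul (a := ENNReal.ofReal (D ^ (1 / q)) *
        max (eLpNorm u₀ 1 volume) (eLpNorm u₀ (ENNReal.ofReal q) volume)) h1
        (Or.inr (by rw [hnorm1, hnormq, ← ENNReal.ofReal_max]
                    exact ENNReal.mul_ne_top ENNReal.ofReal_ne_top ENNReal.ofReal_ne_top))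
      simpa using h2
    refine tendsto_of_tendsto_of_tendsto_of_le_of_le' tendsto_const_nhds hz
      (Eventually.of_forall fun _ => zero_le) ?_
    filter_upwards [eventually_gt_atTop 0] with t ht using hbound t ht
  · have hlim : Tendsto (fun η : ℝ => ENNReal.ofReal ((D * m ^ q + η) ^ (1 / q))) (𝓝[>] 0)
        (𝓝 (ENNReal.ofReal (D ^ (1 / q)) * eLpNorm u₀ 1 volume)) := by
      have h1 : (D * m ^ q + 0) ^ (1 / q) = D ^ (1 / q) * m := by
        rw [add_zero, Real.mul_rpow hD.le (by positivity), ← Real.rpow_mul hm0,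
          mul_one_div_cancel hq0.ne', Real.rpow_one]
      rw [hnorm1, ← ENNReal.ofReal_mul (by positivity), ← h1]
      have hc : Continuous fun η : ℝ => (D * m ^ q + η) ^ (1 / q) :=
        (continuous_const.add continuous_id).rpow_const fun _ => Or.inr (by positivity)
      exact (ENNReal.tendsto_ofReal (hc.tendsto 0)).mono_left nhdsWithin_le_nhds
    refine ge_of_tendsto hlim ?_
    filter_upwards [self_mem_nhdsWithin] with η hη
    refine limsup_le_of_le (by isBoundedDefault) ?_
    filter_upwards [hasymp η hη, eventually_gt_atTop 0] with t ht ht0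
    rw [hnorm t ht0.le, ← ENNReal.ofReal_mul (by positivity), hmul t ht0]
    exact ENNReal.ofReal_le_ofReal
      (Real.rpow_le_rpow (mul_nonneg (by positivity) (hY0 t)) ht (by positivity))
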